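/- **Conventions.** $\Delta_{k-1}=\{t\in[0,1]^k : \sum t_i=1\}$, viewed as a CW complex whose open cells are its open faces. CW complexes are Hausdorff. Powers $X^k$ carry the compactly generated ($k$-ified) product topology, as usual for CW complexes. For a space $X$ and $n\ge 0$, the $n$-th barycenter space is the quotient space $$\bar n(X)=\Big(\coprod_{k=1}^n \Delta_{k-1}\times X^k\Big)\Big/\!\sim,$$ where $\sim$ is generated by: the diagonal action of the symmetric group $\mathfrak S_k$ on $\Delta_{k-1}\times X^k$; $(t;x)\sim(t_1,\dots,\widehat{t_i},\dots,t_k;x_1,\dots,\widehat{x_i},\dots,x_k)$ if $t_i=0$; and, if $x_i=x_j$ with $i\ne j$, $(t;x)\sim(t';x')$, where $(t';x')$ is obtained by replacing $t_i$ by $t_i+t_j$ and then deleting $t_j$ and $x_j$. A map of CW complexes is cellular if it is continuous and sends $d$-skeleton to $d$-skeleton for every $d$; a subcomplex inclusion is a homeomorphism onto a subcomplex that carries open cells to open cells of the same dimension. **Proposition.** Let $X$ be a connected CW complex with basepoint $x_0$. Suppose that the powers $X^k$, $k\ge 0$, are endowed with CW structures (for $k=1$ that of $X$) such that * $\mathfrak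 S_k$ acts cellularly on $X^k$, that is, every permutation carries open cells to open cells, and a permutation that maps an open cell to itself fixes it pointwise; * the maps $X^{k+1}\to X^k$ forgetting one coordinate are cellular; * the maps $X^k\hookrightarrow X^n$ ($k\le n$) adjoining basepoints are subcomplex inclusions (in particular, with $k=0$, $n=1$, $x_0$ is a vertex). (If $x_0$ is a vertex, the ordinary product structures satisfy all of this except the pointwise fixing in the first condition.) Give each $\Delta_{k-1}\times X^k$ the product CW structure, whose open cells are the products of an open face with an open cell. Then all the spaces $\bar n(X)$, $n\ge 0$, can be equipped with CW structures (in particular they are Hausdorff) such that, for all $1\le k\le n$, in the commutative diagram $$\begin{array}{ccc}\Delta_{k-1}\times X^k&\hookrightarrow&\Delta_{n-1}\times X^n\\ \downarrow&&\downarrow\\ \bar k(X)&\hookrightarrow&\bar n(X)\end{array}$$ the vertical projections are cellular and the horizontal maps are subcomplex inclusions. Here the upper map is $(t;x)\mapsto(t_1,\dots,t_k,0,\dots,0;x_1,\dots,x_k,x_0,\dots,x_0)$ and the lower one is induced by the inclusion of the disjoint unions. -/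

import Mathlib

open Set Topology

universe u

noncomputable section

namespace BarycenterCW

/-! ### Cartesian powers -/

/-- The power `X ^ k` as usual for CW complexes: the underlying set is `Fin k → X` and the topology
is the k-ification (compactly generated refinement) of the product topology. -/
abbrev Power (X : Type u) (k : ℕ) : Type u := CompactCoherentification (Fin k → X)

section Power

variable {X : Type u}

/-- The tuple underlying a point of `X ^ k`. -/
def Power.coord {k : ℕ} (x : Power X k) : Fin k → X :=
  (CompactCoherentification.mk (Fin k → X)).symm x

/-- Rearranging coordinates along `u : Fin m → Fin k`:
`(x₁, …, x_k) ↦ (x_{u 1}, …, x_{u m})`. -/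
def Power.reindex {k m : ℕ} (u : Fin m → Fin k) : Power X k → Power X m :=
  CompactCoherentification.map fun x => x ∘ u

/-- `(x₁, …, x_k) ↦ (x₁, …, x_k, x₀, …, x₀)`, from `X ^ k` to `X ^ n`; used for `k ≤ n`. -/
def Power.adjoin (x₀ : X) (k n : ℕ) : Power X k → Power X n :=
  CompactCoherentification.map fun x i => if h : (i : ℕ) < k then x ⟨i, h⟩ else x₀

end Power

/-! ### Maps of CW complexes -/

section Maps

variable {Y Z : Type u} [TopologicalSpace Y] [TopologicalSpace Z]

/-- A cellular map: continuous, and the `d`-skeleton is sent into the `d`-skeleton for all `d`. -/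
def IsCellular [T2Space Y] [T2Space Z] [CWComplex (univ : Set Y)] [CWComplex (univ : Set Z)]
    (f : Y → Z) : Prop :=
  Continuous f ∧ ∀ d : ℕ,
    MapsTo f (RelCWComplex.skeleton (univ : Set Y) d) (RelCWComplex.skeleton (univ : Set Z) d)

/-- A subcomplex inclusion: a homeomorphism onto (the underlying space of) a subcomplex which
carries each open cell onto an open cell of the same dimension. -/
def IsSubcomplexInclusion [CWComplex (univ : Set Y)] [CWComplex (univ : Set Z)]
    (f : Y → Z) : Prop :=
  IsEmbedding f ∧
  (∃ E : CWComplex.Subcomplex (univ : Set Z), (E : Set Z) = range f) ∧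
  ∀ (d : ℕ) (e : RelCWComplex.cell (univ : Set Y) d), ∃ e' : RelCWComplex.cell (univ : Set Z) d,
    f '' RelCWComplex.openCell d e = RelCWComplex.openCell d e'

end Maps

/-! ### CW structures on the powers -/

/-- `X` is a CW complex based at `x₀`, and the powers `X ^ k` carry CW structures such that
* on `X ^ 1 = X` it is the given one,
* the symmetric group acts cellularly on `X ^ k`: permutations carry open cells to open cells, and
  a permutation which preserves an open cell fixes it pointwise,
* the maps `X ^ (k + 1) → X ^ k` forgetting a coordinate are cellular,
* the maps `X ^ k → X ^ n` adjoining basepoints are subcomplex inclusions (for `k = 0`, `n = 1`: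
  the basepoint is a vertex).

If `x₀` is a vertex, all of this holds for the product cell structures on the powers, except that
a permutation preserving an open cell need not fix it pointwise. -/
structure IsEquivariantCWPowers (X : Type u) [TopologicalSpace X] [T2Space X]
    [CWComplex (univ : Set X)] (x₀ : X) [∀ k, CWComplex (univ : Set (Power X k))] : Prop where
  one : ∀ (d : ℕ) (e : RelCWComplex.cell (univ : Set X) d),
    ∃ e' : RelCWComplex.cell (univ : Set (Power X 1)) d,
      RelCWComplex.openCell d e' = {x : Power X 1 | x.coord 0 ∈ RelCWComplex.openCell d e}
  perm_cell : ∀ (k : ℕ) (g : Equiv.Perm (Fin k)) (d : ℕ)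
    (e : RelCWComplex.cell (univ : Set (Power X k)) d),
    ∃ e' : RelCWComplex.cell (univ : Set (Power X k)) d,
      Power.reindex g '' RelCWComplex.openCell d e = RelCWComplex.openCell d e'
  perm_fix : ∀ (k : ℕ) (g : Equiv.Perm (Fin k)) (d : ℕ)
    (e : RelCWComplex.cell (univ : Set (Power X k)) d),
    Power.reindex g '' RelCWComplex.openCell d e = RelCWComplex.openCell d e →
      ∀ x ∈ RelCWComplex.openCell d e, Power.reindex g x = x
  forget_cellular : ∀ (k : ℕ) (i : Fin (k + 1)),
    IsCellular (Power.reindex i.succAbove : Power X (k + 1) → Power X k)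
  adjoin_subcomplex : ∀ k n : ℕ, k ≤ n →
    IsSubcomplexInclusion (Power.adjoin x₀ k n : Power X k → Power X n)

/-! ### Barycenter spaces -/

section Barycenter

variable (X : Type u)

/-- `Δ_{k-1} × X ^ k`. -/
abbrev SimplexPower (k : ℕ) : Type u := stdSimplex ℝ (Fin k) × Power X k

/-- The disjoint union of the spaces `Δ_{k-1} × X ^ k` over `k = 1, …, n`
(the summand with index `k : Fin n` is `Δ_k × X ^ (k + 1)`). -/
abbrev PreBarycenter (n : ℕ) : Type u := Σ k : Fin n, SimplexPower X (k + 1)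

/-- The identifications defining the barycenter space. -/
inductive BarycenterStep (n : ℕ) : PreBarycenter X n → PreBarycenter X n → Prop
  /-- The diagonal action of the symmetric group. -/
  | perm (k : Fin n) (g : Equiv.Perm (Fin (k + 1))) (t s : stdSimplex ℝ (Fin (k + 1)))
      (x : Power X (k + 1)) (hs : ∀ l, s.1 l = t.1 (g l)) :
      BarycenterStep n ⟨k, t, x⟩ ⟨k, s, x.reindex g⟩
  /-- If `t_i = 0`, then `t_i` and `x_i` may be suppressed. -/
  | drop (k : ℕ) (hk : k + 1 < n) (i : Fin (k + 2)) (t : stdSimplex ℝ (Fin (k + 2)))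
      (s : stdSimplex ℝ (Fin (k + 1))) (x : Power X (k + 2)) (ht : t.1 i = 0)
      (hs : ∀ l, s.1 l = t.1 (i.succAbove l)) :
      BarycenterStep n ⟨⟨k + 1, hk⟩, t, x⟩
        ⟨⟨k, Nat.lt_of_succ_lt hk⟩, s, x.reindex i.succAbove⟩
  /-- If `x_i = x_j`, then `t_j` may be added to `t_i`, and `t_j` and `x_j` suppressed. -/
  | merge (k : ℕ) (hk : k + 1 < n) (i j : Fin (k + 2)) (hij : i ≠ j)
      (t : stdSimplex ℝ (Fin (k + 2))) (s : stdSimplex ℝ (Fin (k + 1))) (x : Power X (k + 2))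
      (hx : x.coord i = x.coord j)
      (hs : ∀ l, s.1 l = t.1 (j.succAbove l) + if j.succAbove l = i then t.1 j else 0) :
      BarycenterStep n ⟨⟨k + 1, hk⟩, t, x⟩
        ⟨⟨k, Nat.lt_of_succ_lt hk⟩, s, x.reindex j.succAbove⟩

/-- The `n`-th barycenter space: the quotient of `∐ Δ_{k-1} × X ^ k`, `1 ≤ k ≤ n`, by the
equivalence relation generated by the identifications above. -/
def BarycenterSpace (n : ℕ) : Type u := Quot (BarycenterStep X n)

/-- The quotient topology. -/
instance [TopologicalSpace X] (n : ℕ) : TopologicalSpace (BarycenterSpace X n) :=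
  inferInstanceAs (TopologicalSpace (Quot (BarycenterStep X n)))

variable {X}

/-- The projection from `Δ_k × X ^ (k + 1)` to the `(k + 1)`-st barycenter space. -/
def barycenterProj (k : ℕ) (p : SimplexPower X (k + 1)) : BarycenterSpace X (k + 1) :=
  Quot.mk _ ⟨Fin.last k, p⟩

/-- The inclusion of the `k`-th barycenter space in the `n`-th one, for `k ≤ n`. -/
def barycenterIncl {k n : ℕ} (h : k ≤ n) : BarycenterSpace X k → BarycenterSpace X n :=
  Quot.map (fun p => ⟨Fin.castLE h p.1, p.2⟩) (by
    rintro _ _ (⟨k, g, t, s, x, hs⟩ | ⟨k, hk, i, t, s, x, ht, hs⟩ |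
      ⟨k, hk, i, j, hij, t, s, x, hx, hs⟩)
    · exact .perm (Fin.castLE h k) g t s x hs
    · exact .drop k (hk.trans_le h) i t s x ht hs
    · exact .merge k (hk.trans_le h) i j hij t s x hx hs)

/-- `(t, x) ↦ (t₁, …, t_k, 0, …, 0; x₁, …, x_k, x₀, …, x₀)`. -/
def simplexPowerIncl (x₀ : X) {k n : ℕ} (h : k ≤ n) (p : SimplexPower X k) : SimplexPower X n :=
  (stdSimplex.map (Fin.castLE h) p.1, p.2.adjoin x₀ k n)

/-- The open face of `Δ_{k-1}` spanned by a set `S` of vertices. -/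
def openFace {k : ℕ} (S : Finset (Fin k)) : Set (stdSimplex ℝ (Fin k)) :=
  {t | ∀ i, 0 < t.1 i ↔ i ∈ S}

/-- The given CW structure on `Δ_{k-1} × X ^ k` is the product one: its open `d`-cells are exactly
the products of an open face of the simplex with an open cell of `X ^ k` of total dimension `d`. -/
def IsProductCW [TopologicalSpace X] (k : ℕ) [CWComplex (univ : Set (Power X k))]
    [CWComplex (univ : Set (SimplexPower X k))] : Prop :=
  ∀ (d : ℕ) (A : Set (SimplexPower X k)),
    (∃ c : RelCWComplex.cell (univ : Set (SimplexPower X k)) d, RelCWComplex.openCell d c = A) ↔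
    ∃ (S : Finset (Fin k)) (b : ℕ) (e : RelCWComplex.cell (univ : Set (Power X k)) b),
      S.Nonempty ∧ d + 1 = S.card + b ∧ A = openFace S ×ˢ RelCWComplex.openCell b e

end Barycenter

end BarycenterCW

end

/-!
A point `(t; x)` of the barycenter space is recorded by the measure `∑ t_i δ_{x_i}` on `X`. All the
identifications preserve this measure (`weightedSum_eq_of_step`). Conversely, suppressing zero
weights and merging equal points turns every `(t; x)` into a *reduced* pair, with positive weights
and distinct points (`exists_isReduced`), which the measure determines up to a permutation
(`exists_equiv_of_weightedSum_eq`). So measures are a complete invariant of points.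

Hence barycenter spaces are Hausdorff: distinct measures have distinct integrals against some
function `φ` on `X`; only the values of `φ` on the two finite supports matter, and on a CW complex
any values on a finite set are interpolated by a continuous function, built over the skeletons with
Tietze's theorem (`exists_continuous_eqOn`). Integration against a continuous function is continuous
on the barycenter space.

The open cells of `n̄(X)` are the images of (open top face of `Δ_k`) × `E`, where `k < n` and `E` is
an open cell of `X ^ (k + 1)` off the fat diagonal. Because a permutation preserving a cell fixes it
pointwise, a cell meeting the fat diagonal lies in it, and the projection is injective on the
products just described; two of them have equal or disjoint images. Passing to the reduced form
forgets coordinates, which is cellular on the powers of `X`, and does not increase the number of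
positive weights. So the projection does not raise the dimension of cells, and boundaries of cells
go to cells of lower dimension. Closure finiteness holds because there are finitely many ways to
forget coordinates and a compact set meets finitely many open cells of each power.

The two kinds of CW structures, on `Δ_{k-1} × X ^ k` and on `n̄(X)`, are produced from their families
of open cells by `IsCellDecomposition.exists_cwComplex`. A continuous injection carrying open cells
onto open cells of the same dimension is automatically a subcomplex inclusion
(`isSubcomplexInclusion_of_openCells`), which leaves only set-level checks for the horizontal maps.
-/

noncomputable section

namespace BarycenterCW

/-! ### Cell decompositions as families of subsets -/

section CellDecomposition

open Metric

variable {Z : Type u} [TopologicalSpace Z]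

/-- The family of open `d`-cells of a CW complex, as subsets of the underlying space. -/
def openCells (Z : Type u) [TopologicalSpace Z] [CWComplex (univ : Set Z)] (d : ℕ) :
    Set (Set Z) :=
  range (RelCWComplex.openCell (C := (univ : Set Z)) d)

/-- A CW structure recorded only by its open cells: `𝒞 d` is the set of open `d`-cells, as subsets
of `Z`, and characteristic maps are required to exist without being chosen. -/
structure IsCellDecomposition (𝒞 : ℕ → Set (Set Z)) : Prop where
  exists_charMap : ∀ d, ∀ A ∈ 𝒞 d, ∃ f : (Fin d → ℝ) → Z, ContinuousOn f (closedBall 0 1) ∧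
    InjOn f (ball 0 1) ∧ f '' ball 0 1 = A ∧ ∀ v ∈ sphere (0 : Fin d → ℝ) 1,
      ∃ m < d, ∃ B ∈ 𝒞 m, f v ∈ B
  eq_of_mem : ∀ {d d' A B z}, A ∈ 𝒞 d → B ∈ 𝒞 d' → z ∈ A → z ∈ B → d = d' ∧ A = B
  closure_finite : ∀ d, ∀ A ∈ 𝒞 d, ∃ F : Set (Set Z), F.Finite ∧ (∀ B ∈ F, ∃ m, B ∈ 𝒞 m) ∧
    closure A ⊆ ⋃₀ F
  isClosed_of_inter : ∀ A : Set Z, (∀ d, ∀ B ∈ 𝒞 d, IsClosed (A ∩ closure B)) → IsClosed A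
  exists_mem : ∀ z, ∃ d, ∃ A ∈ 𝒞 d, z ∈ A

/-- A continuous map on a closed ball takes it onto the closure of the image of the open ball. -/
lemma image_closedBall_eq_closure [T2Space Z] {d : ℕ} {f : (Fin d → ℝ) → Z}
    (hf : ContinuousOn f (closedBall 0 1)) : f '' closedBall 0 1 = closure (f '' ball 0 1) := by
  apply subset_antisymm
  · rw [← closure_ball (0 : Fin d → ℝ) one_ne_zero] at hf ⊢
    exact hf.image_closure
  · exact closure_minimal (image_mono ball_subset_closedBall)
      ((isCompact_closedBall _ _).image_of_continuousOn hf).isClosed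

/-- A continuous map on a closed ball into a Hausdorff space which is injective on the open ball and
separates it from the boundary sphere has a continuous inverse on the image of the open ball. -/
lemma continuousOn_symm_of_charMap [T2Space Z] {d : ℕ} (f : PartialEquiv (Fin d → ℝ) Z)
    (hs : f.source = ball 0 1) (hf : ContinuousOn f (closedBall 0 1))
    (hd : ∀ v ∈ sphere (0 : Fin d → ℝ) 1, f v ∉ f.target) : ContinuousOn f.symm f.target := by
  rw [continuousOn_iff_isClosed]
  intro t ht
  refine ⟨f '' (t ∩ closedBall 0 1), ?_, ?_⟩
  · exact (((isCompact_closedBall _ _).inter_left ht).image_of_continuousOn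
      (hf.mono inter_subset_right)).isClosed
  · ext z
    constructor
    · rintro ⟨hz, hzt⟩
      refine ⟨⟨f.symm z, ⟨hz, ?_⟩, f.right_inv hzt⟩, hzt⟩
      exact ball_subset_closedBall (hs ▸ f.map_target hzt)
    · rintro ⟨⟨v, ⟨hv, hvb⟩, rfl⟩, hzt⟩
      refine ⟨?_, hzt⟩
      have hvs : v ∈ f.source := by
        rw [hs]
        rcases (mem_closedBall.1 hvb).lt_or_eq with h | h
        · exact h
        · exact absurd hzt (hd v h)
      simpa [f.left_inv hvs] using hv

lemma IsCellDecomposition.isCompact_closure [T2Space Z] {𝒞 : ℕ → Set (Set Z)}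
    (h : IsCellDecomposition 𝒞) {d : ℕ} {A : Set Z} (hA : A ∈ 𝒞 d) : IsCompact (closure A) := by
  obtain ⟨f, hf, -, rfl, -⟩ := h.exists_charMap d A hA
  rw [← image_closedBall_eq_closure hf]
  exact (isCompact_closedBall _ _).image_of_continuousOn hf

/-- A cell decomposition of a Hausdorff space is the family of open cells of a CW structure: the
inverses of the characteristic maps are continuous on open cells because closed balls are compact,
and finitely many cells of lower dimension cover each boundary because cells are disjoint. -/
theorem IsCellDecomposition.exists_cwComplex [T2Space Z] {𝒞 : ℕ → Set (Set Z)}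
    (h : IsCellDecomposition 𝒞) :
    ∃ _ : CWComplex (univ : Set Z), ∀ d, openCells Z d = 𝒞 d := by
  choose f hfc hfi hfA hfs using fun d (A : 𝒞 d) => h.exists_charMap d A.1 A.2
  have hcl (d : ℕ) (A : 𝒞 d) : f d A '' closedBall 0 1 = closure A.1 := by
    rw [image_closedBall_eq_closure (hfc d A), hfA]
  refine ⟨
    { cell := fun d => 𝒞 d
      map := fun d A => (hfi d A).toPartialEquiv
      source_eq := fun d A => rfl
      continuousOn := fun d A => hfc d A
      continuousOn_symm := ?_
      pairwiseDisjoint' := ?_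
      mapsTo' := ?_
      closed' := ?_
      union' := ?_ }, ?_⟩
  · intro d A
    refine continuousOn_symm_of_charMap _ rfl (hfc d A) ?_
    intro v hv hvt
    obtain ⟨m, hm, B, hB, hvB⟩ := hfs d A v hv
    have hvt : f d A v ∈ A.1 := by rw [← hfA d A]; exact hvt
    exact hm.ne (h.eq_of_mem hB A.2 hvB hvt).1
  · rintro ⟨d, A⟩ - ⟨d', B⟩ - hne
    rw [Function.onFun, Set.disjoint_left]
    rintro z hz hz'
    have hz : z ∈ A.1 := by rw [← hfA d A]; exact hz
    have hz' : z ∈ B.1 := by rw [← hfA d' B]; exact hz'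
    obtain ⟨rfl, hAB⟩ := h.eq_of_mem A.2 B.2 hz hz'
    exact hne (by rw [Subtype.ext hAB])
  · intro d A
    obtain ⟨F, hF, hF𝒞, hFA⟩ := h.closure_finite d A.1 A.2
    have hfin (m : ℕ) : {B : 𝒞 m | B.1 ∈ F}.Finite := hF.preimage Subtype.val_injective.injOn
    refine ⟨fun m => (hfin m).toFinset, ?_⟩
    intro v hv
    obtain ⟨m, hm, B, hB, hvB⟩ := hfs d A v hv
    obtain ⟨B', hB'F, hvB'⟩ := hFA (by
      rw [← hcl d A]; exact mem_image_of_mem _ (sphere_subset_closedBall hv) : f d A v ∈ closure A.1)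
    obtain ⟨m', hB'⟩ := hF𝒞 B' hB'F
    obtain ⟨rfl, rfl⟩ := h.eq_of_mem hB hB' hvB hvB'
    simp only [mem_iUnion]
    refine ⟨m, hm, ⟨B, hB⟩, (hfin m).mem_toFinset.2 hB'F, ?_⟩
    change f d A v ∈ f m ⟨B, hB⟩ '' closedBall 0 1
    rw [hcl]
    exact subset_closure hvB
  · intro A _ hA
    refine h.isClosed_of_inter A fun d B hB => ?_
    rw [← hcl d ⟨B, hB⟩]
    exact hA d ⟨B, hB⟩
  · rw [eq_univ_iff_forall]
    intro z
    obtain ⟨d, A, hA, hz⟩ := h.exists_mem z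
    simp only [mem_iUnion]
    refine ⟨d, ⟨A, hA⟩, ?_⟩
    change z ∈ f d ⟨A, hA⟩ '' closedBall 0 1
    rw [hcl]
    exact subset_closure hz
  · intro d
    ext A
    constructor
    · rintro ⟨B, rfl⟩
      change f d B '' ball 0 1 ∈ 𝒞 d
      rw [hfA]
      exact B.2
    · intro hA
      exact ⟨⟨A, hA⟩, hfA d ⟨A, hA⟩⟩

variable [CWComplex (univ : Set Z)]

lemma eq_of_mem_openCells {d d' : ℕ} {A B : Set Z} {z : Z} (hA : A ∈ openCells Z d)
    (hB : B ∈ openCells Z d') (hzA : z ∈ A) (hzB : z ∈ B) : d = d' ∧ A = B := by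
  obtain ⟨i, rfl⟩ := hA
  obtain ⟨j, rfl⟩ := hB
  have := RelCWComplex.eq_of_not_disjoint_openCell (Set.not_disjoint_iff.2 ⟨z, hzA, hzB⟩)
  obtain ⟨rfl, h⟩ := Sigma.mk.inj_iff.1 this
  rw [eq_of_heq h]
  exact ⟨rfl, rfl⟩

lemma exists_mem_openCells (z : Z) : ∃ d, ∃ A ∈ openCells Z d, z ∈ A := by
  have hz : z ∈ (univ : Set Z) := mem_univ z
  rw [← CWComplex.iUnion_openCell_eq_complex (C := (univ : Set Z))] at hz
  simp only [mem_iUnion] at hz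
  obtain ⟨d, j, hz⟩ := hz
  exact ⟨d, _, ⟨j, rfl⟩, hz⟩

lemma closedCell_subset_finite (d : ℕ) (j : RelCWComplex.cell (univ : Set Z) d) :
    ∃ F : Set (Set Z), F.Finite ∧ (∀ B ∈ F, ∃ m, B ∈ openCells Z m) ∧
      RelCWComplex.closedCell d j ⊆ ⋃₀ F := by
  obtain ⟨I, hI⟩ := CWComplex.cellFrontier_subset_finite_openCell d j
  refine ⟨insert (RelCWComplex.openCell d j)
    (⋃ m ∈ Iio d, RelCWComplex.openCell m '' (↑(I m) : Set (RelCWComplex.cell (univ : Set Z) m))), ?_, ?_, ?_⟩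
  · exact ((finite_Iio d).biUnion fun m _ => (I m).finite_toSet.image _).insert _
  · rintro B (rfl | hB)
    · exact ⟨d, j, rfl⟩
    · simp only [mem_iUnion] at hB
      obtain ⟨m, _, i, _, rfl⟩ := hB
      exact ⟨m, i, rfl⟩
  · rw [← RelCWComplex.cellFrontier_union_openCell_eq_closedCell]
    rintro z (hz | hz)
    · have := hI hz
      simp only [mem_iUnion] at this
      obtain ⟨m, hm, i, hi, hz⟩ := this
      refine ⟨_, Or.inr ?_, hz⟩
      simp only [mem_iUnion]
      exact ⟨m, hm, i, hi, rfl⟩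
    · exact ⟨_, Or.inl rfl, hz⟩

variable [T2Space Z]

lemma mem_skeleton_iff_openCells {d : ℕ} {z : Z} :
    z ∈ (RelCWComplex.skeleton (univ : Set Z) d : Set Z) ↔
      ∃ m ≤ d, ∃ A ∈ openCells Z m, z ∈ A := by
  rw [SetLike.mem_coe, CWComplex.mem_skeleton_iff]
  constructor
  · rintro ⟨m, hm, j, hz⟩
    exact ⟨m, by exact_mod_cast hm, _, ⟨j, rfl⟩, hz⟩
  · rintro ⟨m, hm, _, ⟨j, rfl⟩, hz⟩
    exact ⟨m, by exact_mod_cast hm, j, hz⟩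

/-- A compact subset of a CW complex meets only finitely many open cells: a choice of one point in
each open cell that is met is a closed discrete subset. -/
lemma finite_openCells_inter_compact {K : Set Z} (hK : IsCompact K) :
    {B : Set Z | (∃ m, B ∈ openCells Z m) ∧ (B ∩ K).Nonempty}.Finite := by
  set G := {B : Set Z | (∃ m, B ∈ openCells Z m) ∧ (B ∩ K).Nonempty}
  choose p hp using fun B : G => B.2.2
  have hpinj : Function.Injective p := by
    intro B B' hBB
    obtain ⟨m, hm⟩ := B.2.1
    obtain ⟨m', hm'⟩ := B'.2.1
    exact Subtype.ext (eq_of_mem_openCells hm hm' (hp B).1 (hBB ▸ (hp B').1)).2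
  have hcl : ∀ S ⊆ range p, IsClosed S := by
    intro S hS
    rw [CWComplex.closed (univ : Set Z) S (subset_univ _)]
    intro n j
    obtain ⟨F, hF, hFc, hFj⟩ := closedCell_subset_finite n j
    refine Set.Finite.isClosed (Set.Finite.subset
      ((hF.preimage Subtype.val_injective.injOn).image p) ?_)
    rintro z ⟨hzS, hzj⟩
    obtain ⟨B, rfl⟩ := hS hzS
    obtain ⟨B', hB'F, hzB'⟩ := hFj hzj
    obtain ⟨m, hm⟩ := B.2.1
    obtain ⟨m', hm'⟩ := hFc B' hB'F
    refine ⟨B, ?_, rfl⟩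
    rw [mem_preimage, (eq_of_mem_openCells hm hm' (hp B).1 hzB').2]
    exact hB'F
  have hfin : (range p).Finite := by
    refine IsCompact.finite (hK.of_isClosed_subset (hcl _ subset_rfl) ?_) ?_
    · rintro _ ⟨B, rfl⟩
      exact (hp B).2
    · refine ⟨discreteTopology_iff_forall_isClosed.2 fun s => ?_⟩
      rw [← preimage_image_eq s Subtype.val_injective]
      exact (hcl _ (Subtype.coe_image_subset _ _)).preimage continuous_subtype_val
  have := Set.finite_range_iff hpinj |>.1 hfin
  exact Set.toFinite G

/-- A continuous injective map of CW complexes which carries open cells onto open cells of the same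
dimension is a subcomplex inclusion: it is a closed map because each closed cell of the target meets
only finitely many open cells in the image. -/
theorem isSubcomplexInclusion_of_openCells {Y : Type u} [TopologicalSpace Y] [T2Space Y]
    [CWComplex (univ : Set Y)] {f : Y → Z} (hf : Continuous f) (hinj : Function.Injective f)
    (hcell : ∀ d, ∀ A ∈ openCells Y d, f '' A ∈ openCells Z d) : IsSubcomplexInclusion f := by
  have hclosed : IsClosedMap f := by
    intro A hA
    rw [CWComplex.closed (univ : Set Z) _ (subset_univ _)]
    intro n j
    obtain ⟨F, hF, hFc, hFj⟩ := closedCell_subset_finite n j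
    set G := {c : Set Y | (∃ m, c ∈ openCells Y m) ∧ f '' c ∈ F}
    have hG : G.Finite :=
      Set.Finite.subset (hF.preimage (image_injective.2 hinj).injOn) fun c hc => hc.2
    have heq : f '' A ∩ RelCWComplex.closedCell n j =
        (⋃ c ∈ G, f '' (A ∩ closure c)) ∩ RelCWComplex.closedCell n j := by
      apply subset_antisymm
      · rintro _ ⟨⟨y, hy, rfl⟩, hyj⟩
        refine ⟨?_, hyj⟩
        obtain ⟨B, hBF, hyB⟩ := hFj hyj
        obtain ⟨m, hm⟩ := hFc B hBF
        obtain ⟨m', c, hc, hyc⟩ := exists_mem_openCells y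
        have := (eq_of_mem_openCells hm (hcell m' c hc) hyB (mem_image_of_mem f hyc)).2
        simp only [mem_iUnion]
        exact ⟨c, ⟨⟨m', hc⟩, this ▸ hBF⟩, y, ⟨hy, subset_closure hyc⟩, rfl⟩
      · refine inter_subset_inter_left _ ?_
        simp only [iUnion_subset_iff]
        exact fun c _ => image_mono inter_subset_left
    rw [heq]
    refine IsClosed.inter (hG.isClosed_biUnion fun c hc => ?_) RelCWComplex.isClosed_closedCell
    obtain ⟨m, i, rfl⟩ := hc.1
    rw [RelCWComplex.closure_openCell_eq_closedCell]
    exact ((RelCWComplex.isCompact_closedCell.inter_left hA).image hf).isClosed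
  refine ⟨(IsClosedEmbedding.of_continuous_injective_isClosedMap hf hinj hclosed).isEmbedding,
    ⟨{ carrier := range f
       I := fun n => {j | RelCWComplex.openCell n j ⊆ range f}
       closed' := hclosed.isClosed_range
       union' := ?_ }, rfl⟩, ?_⟩
  · rw [empty_union]
    apply subset_antisymm
    · simp only [iUnion_subset_iff]
      exact fun n j => j.2
    · rintro _ ⟨y, rfl⟩
      obtain ⟨d, c, hc, hyc⟩ := exists_mem_openCells y
      obtain ⟨j, hj⟩ := hcell d c hc
      simp only [mem_iUnion]
      refine ⟨d, ⟨j, ?_⟩, ?_⟩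
      · rw [mem_ofPred_eq, hj]
        exact image_subset_range _ _
      · change f y ∈ RelCWComplex.openCell d j
        rw [hj]
        exact mem_image_of_mem f hyc
  · intro d e
    obtain ⟨e', he'⟩ := hcell d _ ⟨e, rfl⟩
    exact ⟨e', he'.symm⟩

end CellDecomposition

/-! ### Interpolation by continuous functions on a CW complex -/

section Interpolation

open Metric

variable {X : Type u} [TopologicalSpace X] [T2Space X] [CWComplex (univ : Set X)]

local notation "sk" => RelCWComplex.skeletonLT (univ : Set X)

/-- A function which is continuous on the `(n - 1)`-skeleton can be changed on the open `n`-cells,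
away from a finite set, so as to become continuous on the `n`-skeleton. -/
lemma exists_continuousOn_skeletonLT_succ {F : Set X} (hF : F.Finite) (n : ℕ) (f : X → ℝ)
    (hf : ContinuousOn f (sk n)) :
    ∃ g : X → ℝ, ContinuousOn g (sk (n + 1 : ℕ)) ∧ EqOn g f (sk n) ∧ EqOn g f F := by
  classical
  let φ (i : RelCWComplex.cell (univ : Set X) n) := RelCWComplex.map (C := (univ : Set X)) n i
  have hsrc (i) : (φ i).source = ball 0 1 := RelCWComplex.source_eq n i
  have hφ (i) : ContinuousOn (φ i) (closedBall 0 1) := RelCWComplex.continuousOn n i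
  have hsphere (i) : ∀ v ∈ sphere (0 : Fin n → ℝ) 1, φ i v ∈ (sk n : Set X) := fun v hv =>
    RelCWComplex.cellFrontier_subset_skeletonLT n i (mem_image_of_mem _ hv)
  -- The new values on the cell `i` come from Tietze's theorem, with values prescribed on the
  -- boundary sphere and on the finite set of interior points lying over `F`.
  have hext (i) : ∃ h : C(Fin n → ℝ, ℝ), (∀ v ∈ sphere (0 : Fin n → ℝ) 1, h v = f (φ i v)) ∧
      ∀ v ∈ ball (0 : Fin n → ℝ) 1, φ i v ∈ F → h v = f (φ i v) := by
    set P : Set (Fin n → ℝ) := ball 0 1 ∩ φ i ⁻¹' F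
    have hP : P.Finite := by
      refine Set.Finite.of_finite_image (f := φ i) (hF.subset ?_) ?_
      · rintro _ ⟨v, hv, rfl⟩
        exact hv.2
      · exact (hsrc i ▸ (φ i).injOn).mono inter_subset_left
    have hc : ContinuousOn (fun v => f (φ i v)) (sphere 0 1 ∪ P) := by
      refine ContinuousOn.union_of_isClosed ?_ (hP.continuousOn _)
        isClosed_sphere hP.isClosed
      exact hf.comp ((hφ i).mono sphere_subset_closedBall) (hsphere i)
    obtain ⟨h, hh⟩ := ContinuousMap.exists_restrict_eq (isClosed_sphere.union hP.isClosed)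
      ⟨_, continuousOn_iff_continuous_domRestrict.1 hc⟩
    have hh' : ∀ v ∈ sphere 0 1 ∪ P, h v = f (φ i v) := fun v hv => DFunLike.congr_fun hh ⟨v, hv⟩
    exact ⟨h, fun v hv => hh' v (.inl hv), fun v hv hvF => hh' v (.inr ⟨hv, hvF⟩)⟩
  choose h hhs hhF using hext
  let g : X → ℝ := fun z => if hz : ∃ i, z ∈ RelCWComplex.openCell (C := (univ : Set X)) n i
    then h hz.choose ((φ hz.choose).symm z) else f z
  have hg_ball (i) (v : Fin n → ℝ) (hv : v ∈ ball (0 : Fin n → ℝ) 1) : g (φ i v) = h i v := by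
    have hz : ∃ i', φ i v ∈ RelCWComplex.openCell (C := (univ : Set X)) n i' :=
      ⟨i, mem_image_of_mem _ hv⟩
    have hi : hz.choose = i := by
      have := RelCWComplex.eq_of_not_disjoint_openCell
        (Set.not_disjoint_iff.2 ⟨_, hz.choose_spec, mem_image_of_mem _ hv⟩)
      exact eq_of_heq (Sigma.mk.inj_iff.1 this).2
    simp only [g, dif_pos hz]
    rw [hi, (φ i).left_inv (hsrc i ▸ hv)]
  have hg_sk : EqOn g f (sk n) := by
    intro z hz
    have : ¬ ∃ i, z ∈ RelCWComplex.openCell (C := (univ : Set X)) n i := by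
      rintro ⟨i, hi⟩
      exact Set.disjoint_left.1 (RelCWComplex.disjoint_skeletonLT_openCell le_rfl) hz hi
    simp only [g, dif_neg this]
  have hg_closedBall (i) (v : Fin n → ℝ) (hv : v ∈ closedBall (0 : Fin n → ℝ) 1) :
      g (φ i v) = h i v := by
    rcases (mem_closedBall.1 hv).lt_or_eq with hv | hv
    · exact hg_ball i v hv
    · rw [hg_sk (hsphere i v hv), hhs i v hv]
  refine ⟨g, ?_, hg_sk, ?_⟩
  · rw [continuousOn_iff_isClosed]
    intro t ht
    refine ⟨g ⁻¹' t ∩ sk (n + 1 : ℕ), ?_, by rw [inter_assoc, inter_self]⟩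
    apply CWComplex.isClosed_of_disjoint_openCell_or_isClosed_inter_closedCell (C := (univ : Set X))
      (subset_univ _)
    intro m _ j
    rcases lt_trichotomy m n with hm | rfl | hm
    · right
      have hsub : RelCWComplex.closedCell m j ⊆ (sk n : Set X) :=
        (RelCWComplex.closedCell_subset_skeletonLT m j).trans
          (RelCWComplex.skeletonLT_mono (by exact_mod_cast hm))
      have hsub' : RelCWComplex.closedCell m j ⊆ (sk (n + 1 : ℕ) : Set X) :=
        hsub.trans (RelCWComplex.skeletonLT_mono (by exact_mod_cast n.le_succ))
      have : g ⁻¹' t ∩ sk (n + 1 : ℕ) ∩ RelCWComplex.closedCell m j =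
          RelCWComplex.closedCell m j ∩ f ⁻¹' t := by
        ext z
        simp only [mem_inter_iff, mem_preimage]
        constructor
        · rintro ⟨⟨hzt, -⟩, hz⟩
          exact ⟨hz, hg_sk (hsub hz) ▸ hzt⟩
        · rintro ⟨hz, hzt⟩
          exact ⟨⟨(hg_sk (hsub hz)).symm ▸ hzt, hsub' hz⟩, hz⟩
      rw [this]
      exact (hf.mono hsub).preimage_isClosed_of_isClosed RelCWComplex.isClosed_closedCell ht
    · right
      have : g ⁻¹' t ∩ sk (m + 1 : ℕ) ∩ RelCWComplex.closedCell m j =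
          φ j '' (closedBall 0 1 ∩ h j ⁻¹' t) := by
        ext z
        constructor
        · rintro ⟨⟨hzt, -⟩, v, hv, rfl⟩
          exact ⟨v, ⟨hv, by rw [mem_preimage, ← hg_closedBall j v hv]; exact hzt⟩, rfl⟩
        · rintro ⟨v, ⟨hv, hvt⟩, rfl⟩
          refine ⟨⟨by rw [mem_preimage, hg_closedBall j v hv]; exact hvt, ?_⟩, v, hv, rfl⟩
          exact RelCWComplex.closedCell_subset_skeletonLT m j (mem_image_of_mem _ hv)
      rw [this]
      exact (((isCompact_closedBall _ _).inter_right
        (ht.preimage (h j).continuous)).image_of_continuousOn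
        ((hφ j).mono inter_subset_left)).isClosed
    · left
      exact (RelCWComplex.disjoint_skeletonLT_openCell (by exact_mod_cast hm)).mono_left
        inter_subset_right
  · intro z hz
    by_cases hzi : ∃ i, z ∈ RelCWComplex.openCell (C := (univ : Set X)) n i
    · obtain ⟨i, v, hv, rfl⟩ := hzi
      exact (hg_ball i v hv).trans (hhF i v hv hz)
    · simp only [g, dif_neg hzi]

/-- On a CW complex, any values on a finite set are attained by a continuous real function. -/
theorem exists_continuous_eqOn {F : Set X} (hF : F.Finite) (φ : X → ℝ) :
    ∃ ψ : X → ℝ, Continuous ψ ∧ EqOn ψ φ F := by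
  have step (n : ℕ) (f : X → ℝ) : ∃ g : X → ℝ, ContinuousOn f (sk n) →
      ContinuousOn g (sk (n + 1 : ℕ)) ∧ EqOn g f (sk n) ∧ EqOn g f F := by
    by_cases hf : ContinuousOn f (sk n)
    · obtain ⟨g, hg⟩ := exists_continuousOn_skeletonLT_succ hF n f hf
      exact ⟨g, fun _ => hg⟩
    · exact ⟨f, fun h => absurd h hf⟩
  choose G hG using step
  let s : ℕ → X → ℝ := fun n => Nat.rec φ G n
  have hs_cont (n : ℕ) : ContinuousOn (s n) (sk n) := by
    induction n with
    | zero =>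
      have : (sk (0 : ℕ) : Set X) = ∅ := CWComplex.skeletonLT_zero_eq_empty
      rw [this]
      exact continuousOn_empty _
    | succ n ih => exact (hG n (s n) ih).1
  have hs_F (n : ℕ) : EqOn (s n) φ F := by
    induction n with
    | zero => exact fun _ _ => rfl
    | succ n ih => exact (hG n (s n) (hs_cont n)).2.2.trans ih
  have hs_eq {m n : ℕ} (hmn : m ≤ n) : EqOn (s n) (s m) (sk m) := by
    induction n, hmn using Nat.le_induction with
    | base => exact fun _ _ => rfl
    | succ n hmn ih =>
      refine EqOn.trans (fun z hz => (hG n (s n) (hs_cont n)).2.1 ?_) ih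
      exact RelCWComplex.skeletonLT_mono (by exact_mod_cast hmn) hz
  have hN (z : X) : ∃ n : ℕ, z ∈ (sk n : Set X) := by
    have hz : z ∈ (univ : Set X) := mem_univ z
    rw [← CWComplex.iUnion_skeletonLT_eq_complex (C := (univ : Set X))] at hz
    exact mem_iUnion.1 hz
  choose N hN using hN
  let ψ : X → ℝ := fun z => s (N z) z
  have hψ (n : ℕ) : EqOn ψ (s n) (sk n) := by
    intro z hz
    rcases le_total n (N z) with h | h
    · exact hs_eq h hz
    · exact (hs_eq h (hN z)).symm
  refine ⟨ψ, ?_, fun z hz => hs_F (N z) hz⟩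
  rw [continuous_iff_isClosed]
  intro t ht
  rw [CWComplex.closed (univ : Set X) _ (subset_univ _)]
  intro n j
  have hsub : RelCWComplex.closedCell n j ⊆ (sk (n + 1 : ℕ) : Set X) :=
    RelCWComplex.closedCell_subset_skeletonLT n j
  have : ψ ⁻¹' t ∩ RelCWComplex.closedCell n j = RelCWComplex.closedCell n j ∩ s (n + 1) ⁻¹' t := by
    ext z
    simp only [mem_inter_iff, mem_preimage]
    constructor
    · rintro ⟨hzt, hz⟩
      exact ⟨hz, hψ (n + 1) (hsub hz) ▸ hzt⟩
    · rintro ⟨hz, hzt⟩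
      exact ⟨(hψ (n + 1) (hsub hz)).symm ▸ hzt, hz⟩
  rw [this]
  exact ((hs_cont (n + 1)).mono hsub).preimage_isClosed_of_isClosed
    RelCWComplex.isClosed_closedCell ht

end Interpolation

/-! ### Open faces of the simplex and their characteristic maps -/

section Faces

open Metric

lemma stdSimplex_map_apply {k n : ℕ} {f : Fin k → Fin n} (hf : Function.Injective f)
    (t : stdSimplex ℝ (Fin k)) (i : Fin k) : (stdSimplex.map f t).1 (f i) = t.1 i := by
  classical
  change FunOnFinite.linearMap ℝ ℝ f t (f i) = t i
  rw [FunOnFinite.linearMap_apply_apply, Finset.sum_eq_single i]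
  · intro j hj hji
    exact absurd (hf (Finset.mem_filter.1 hj).2) hji
  · simp

lemma stdSimplex_map_apply_of_notMem {k n : ℕ} {f : Fin k → Fin n} (t : stdSimplex ℝ (Fin k))
    {j : Fin n} (hj : j ∉ range f) : (stdSimplex.map f t).1 j = 0 := by
  classical
  change FunOnFinite.linearMap ℝ ℝ f t j = 0
  rw [FunOnFinite.linearMap_apply_apply]
  refine Finset.sum_eq_zero fun i hi => absurd ⟨i, (Finset.mem_filter.1 hi).2⟩ hj

lemma stdSimplex_map_injective {k n : ℕ} {f : Fin k → Fin n} (hf : Function.Injective f) :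
    Function.Injective (stdSimplex.map (S := ℝ) f) := by
  intro t s h
  refine Subtype.ext (funext fun i => ?_)
  rw [← stdSimplex_map_apply hf, h, stdSimplex_map_apply hf]

lemma mem_openFace_map_iff {k n : ℕ} {f : Fin k ↪ Fin n} {S : Finset (Fin k)}
    {t : stdSimplex ℝ (Fin k)} : stdSimplex.map f t ∈ openFace (S.map f) ↔ t ∈ openFace S := by
  constructor
  · intro h i
    rw [← stdSimplex_map_apply f.injective, h (f i), Finset.mem_map' f]
  · intro h j
    by_cases hj : j ∈ range f
    · obtain ⟨i, rfl⟩ := hj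
      rw [stdSimplex_map_apply f.injective, h i, Finset.mem_map' f]
    · rw [stdSimplex_map_apply_of_notMem t hj]
      refine iff_of_false (lt_irrefl _) fun h => ?_
      obtain ⟨i, _, hi⟩ := Finset.mem_map.1 h
      exact hj ⟨i, hi⟩

lemma image_map_openFace {k n : ℕ} (f : Fin k ↪ Fin n) (S : Finset (Fin k)) :
    stdSimplex.map (S := ℝ) f '' openFace S = openFace (S.map f) := by
  apply subset_antisymm
  · rintro _ ⟨t, ht, rfl⟩
    exact mem_openFace_map_iff.2 ht
  · intro s hs
    have h0 : ∀ j, j ∉ range f → s.1 j = 0 := by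
      intro j hj
      refine le_antisymm (not_lt.1 fun h => ?_) (s.2.1 j)
      obtain ⟨i, _, hi⟩ := Finset.mem_map.1 ((hs j).1 h)
      exact hj ⟨i, hi⟩
    have hsum : ∑ i, s.1 (f i) = 1 := by
      rw [← s.2.2]
      exact Fintype.sum_of_injective f f.injective _ _ h0 fun _ => rfl
    set t : stdSimplex ℝ (Fin k) := ⟨fun i => s.1 (f i), fun i => s.2.1 _, hsum⟩
    have hts : stdSimplex.map f t = s := by
      refine Subtype.ext (funext fun j => ?_)
      by_cases hj : j ∈ range f
      · obtain ⟨i, rfl⟩ := hj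
        exact stdSimplex_map_apply f.injective t i
      · rw [h0 j hj, stdSimplex_map_apply_of_notMem t hj]
    exact ⟨t, mem_openFace_map_iff.1 (hts ▸ hs), hts⟩

lemma eq_of_mem_openFace {k : ℕ} {S T : Finset (Fin k)} {t : stdSimplex ℝ (Fin k)}
    (hS : t ∈ openFace S) (hT : t ∈ openFace T) : S = T := by
  ext i
  rw [← hS i, hT i]

lemma exists_mem_openFace {k : ℕ} (t : stdSimplex ℝ (Fin k)) :
    ∃ S : Finset (Fin k), S.Nonempty ∧ t ∈ openFace S := by
  classical
  refine ⟨Finset.univ.filter fun i => 0 < t.1 i, ?_, fun i => by simp⟩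
  by_contra h
  have h0 : ∀ i, t.1 i = 0 := by
    intro i
    refine le_antisymm (not_lt.1 fun hi => h ⟨i, by simpa using hi⟩) (t.2.1 i)
  have := t.2.2
  simp [h0] at this

/-- The solid simplex `{x ∈ ℝ ^ d | 0 ≤ x_i, ∑ x_i ≤ 1}`, the projection of `Δ_d` to the last `d`
coordinates. -/
def solidSimplex (d : ℕ) : Set (Fin d → ℝ) := {x | (∀ i, 0 ≤ x i) ∧ ∑ i, x i ≤ 1}

lemma convex_solidSimplex (d : ℕ) : Convex ℝ (solidSimplex d) := by
  rintro x ⟨hx, hx'⟩ y ⟨hy, hy'⟩ a b ha hb hab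
  refine ⟨fun i => ?_, ?_⟩
  · exact add_nonneg (mul_nonneg ha (hx i)) (mul_nonneg hb (hy i))
  · simp only [Pi.add_apply, Pi.smul_apply, smul_eq_mul, Finset.sum_add_distrib, ← Finset.mul_sum]
    nlinarith

lemma isClosed_solidSimplex (d : ℕ) : IsClosed (solidSimplex d) := by
  have : solidSimplex d = (⋂ i, {x | 0 ≤ x i}) ∩ {x | ∑ i, x i ≤ 1} := by
    ext x
    simp [solidSimplex]
  rw [this]
  exact (isClosed_iInter fun i => isClosed_le continuous_const (continuous_apply i)).inter
    (isClosed_le (by fun_prop) continuous_const)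

lemma isBounded_solidSimplex (d : ℕ) : Bornology.IsBounded (solidSimplex d) := by
  refine (isBounded_closedBall (x := (0 : Fin d → ℝ)) (r := 1)).subset fun x hx => ?_
  rw [mem_closedBall_zero_iff, pi_norm_le_iff_of_nonneg zero_le_one]
  intro i
  rw [Real.norm_of_nonneg (hx.1 i)]
  exact (Finset.single_le_sum (fun j _ => hx.1 j) (Finset.mem_univ i)).trans hx.2

lemma interior_solidSimplex (d : ℕ) :
    interior (solidSimplex d) = {x | (∀ i, 0 < x i) ∧ ∑ i, x i < 1} := by
  apply subset_antisymm
  · intro x hx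
    obtain ⟨r, hr, hball⟩ := Metric.isOpen_iff.1 isOpen_interior x hx
    have key (c : ℝ) (hc : |c| < r) : (fun i => x i + c) ∈ solidSimplex d := by
      refine interior_subset (hball ?_)
      rw [mem_ball, dist_pi_lt_iff hr]
      intro i
      simpa [Real.dist_eq] using hc
    refine ⟨fun i => ?_, ?_⟩
    · have := (key (-(r / 2)) (by rw [abs_neg, abs_of_pos] <;> linarith)).1 i
      dsimp only at this
      linarith
    · rcases Nat.eq_zero_or_pos d with rfl | hd
      · simp
      · have := (key (r / 2) (by rw [abs_of_pos] <;> linarith)).2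
        simp only [Finset.sum_add_distrib, Finset.sum_const, Finset.card_univ, Fintype.card_fin,
          nsmul_eq_mul] at this
        have hd' : (0 : ℝ) < d := by exact_mod_cast hd
        have : 0 < d * (r / 2) := by positivity
        linarith
  · refine interior_maximal (fun x hx => ⟨fun i => (hx.1 i).le, hx.2.le⟩) ?_
    have : {x : Fin d → ℝ | (∀ i, 0 < x i) ∧ ∑ i, x i < 1} =
        (⋂ i, {x | 0 < x i}) ∩ {x | ∑ i, x i < 1} := by
      ext x
      simp
    rw [this]
    exact (isOpen_iInter_of_finite fun i => isOpen_lt continuous_const (continuous_apply i)).inter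
      (isOpen_lt (by fun_prop) continuous_const)

/-- The characteristic map of the top cell of `Δ_d`. -/
lemma exists_openFace_univ_charMap (d : ℕ) : ∃ f : (Fin d → ℝ) → stdSimplex ℝ (Fin (d + 1)),
    ContinuousOn f (closedBall 0 1) ∧ InjOn f (ball 0 1) ∧
    f '' ball 0 1 = openFace Finset.univ ∧ ∀ v ∈ sphere (0 : Fin d → ℝ) 1,
      f v ∉ openFace Finset.univ := by
  classical
  have hne : (interior (solidSimplex d)).Nonempty := by
    refine ⟨fun _ => 1 / (d + 1 : ℝ), ?_⟩
    rw [interior_solidSimplex]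
    refine ⟨fun i => by positivity, ?_⟩
    simp only [Finset.sum_const, Finset.card_univ, Fintype.card_fin, nsmul_eq_mul]
    rw [mul_one_div, div_lt_one (by positivity)]
    linarith
  obtain ⟨e, hei, hec, -⟩ := exists_homeomorph_image_interior_closure_frontier_eq_unitBall
    (convex_solidSimplex d) hne (isBounded_solidSimplex d)
  rw [(isClosed_solidSimplex d).closure_eq] at hec
  have hball (v : Fin d → ℝ) : v ∈ ball (0 : Fin d → ℝ) 1 ↔
      (∀ i, 0 < e.symm v i) ∧ ∑ i, e.symm v i < 1 := by
    rw [← hei, interior_solidSimplex, ← e.preimage_symm]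
    rfl
  have hcball (v : Fin d → ℝ) : v ∈ closedBall (0 : Fin d → ℝ) 1 ↔ e.symm v ∈ solidSimplex d := by
    rw [← hec, ← e.preimage_symm]
    rfl
  let c (x : Fin d → ℝ) : Fin (d + 1) → ℝ := Fin.cons (1 - ∑ i, x i) x
  have hc (x) (hx : x ∈ solidSimplex d) : c x ∈ stdSimplex ℝ (Fin (d + 1)) := by
    refine ⟨fun i => ?_, ?_⟩
    · refine Fin.cases ?_ (fun i => ?_) i
      · simpa [c] using hx.2
      · simpa [c] using hx.1 i
    · simp [c, Fin.sum_univ_succ]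
  let f (v : Fin d → ℝ) : stdSimplex ℝ (Fin (d + 1)) :=
    if h : e.symm v ∈ solidSimplex d then ⟨c (e.symm v), hc _ h⟩ else Classical.arbitrary _
  have hf (v) (hv : v ∈ closedBall (0 : Fin d → ℝ) 1) : (f v).1 = c (e.symm v) := by
    simp only [f, dif_pos ((hcball v).1 hv)]
  have hface (v) (hv : v ∈ closedBall (0 : Fin d → ℝ) 1) :
      f v ∈ openFace Finset.univ ↔ v ∈ ball (0 : Fin d → ℝ) 1 := by
    rw [hball]
    simp only [openFace, mem_ofPred_eq, hf v hv, Finset.mem_univ, iff_true, Fin.forall_fin_succ, c,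
      Fin.cons_zero, Fin.cons_succ, sub_pos]
    exact and_comm
  refine ⟨f, ?_, ?_, ?_, ?_⟩
  · rw [IsInducing.subtypeVal.continuousOn_iff]
    refine ContinuousOn.congr (f := fun v => c (e.symm v)) ?_ hf
    refine Continuous.continuousOn ?_
    refine continuous_pi fun i => ?_
    refine Fin.cases ?_ (fun i => ?_) i
    · simp only [c, Fin.cons_zero]
      have := e.symm.continuous
      fun_prop
    · simp only [c, Fin.cons_succ]
      exact (continuous_apply i).comp e.symm.continuous
  · intro v hv w hw hvw
    have h := congrArg Subtype.val hvw
    rw [hf v (ball_subset_closedBall hv), hf w (ball_subset_closedBall hw)] at h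
    exact e.symm.injective (Fin.cons_injective2 h).2
  · apply subset_antisymm
    · rintro _ ⟨v, hv, rfl⟩
      exact (hface v (ball_subset_closedBall hv)).2 hv
    · intro t ht
      have hsum : ∑ i : Fin d, t.1 i.succ = 1 - t.1 0 := by
        have := t.2.2
        rw [Fin.sum_univ_succ] at this
        linarith
      have hv : e (fun i => t.1 i.succ) ∈ ball (0 : Fin d → ℝ) 1 := by
        rw [hball, e.symm_apply_apply, hsum]
        have := (ht 0).2 (Finset.mem_univ _)
        exact ⟨fun i => (ht _).2 (Finset.mem_univ _), by linarith⟩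
      refine ⟨_, hv, Subtype.ext ?_⟩
      rw [hf _ (ball_subset_closedBall hv), e.symm_apply_apply]
      refine funext fun i => Fin.cases ?_ (fun i => ?_) i
      · simp only [c, Fin.cons_zero, hsum]
        ring
      · simp only [c, Fin.cons_succ]
  · intro v hv hv'
    have := (hface v (sphere_subset_closedBall hv)).1 hv'
    rw [mem_ball, mem_sphere.1 hv] at this
    exact lt_irrefl _ this

/-- The characteristic map of an open face of a simplex. -/
lemma exists_openFace_charMap {k d : ℕ} (S : Finset (Fin k)) (hS : S.card = d + 1) :
    ∃ f : (Fin d → ℝ) → stdSimplex ℝ (Fin k),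
      ContinuousOn f (closedBall 0 1) ∧ InjOn f (ball 0 1) ∧ f '' ball 0 1 = openFace S ∧
      ∀ v ∈ sphere (0 : Fin d → ℝ) 1, ∃ T ⊂ S, T.Nonempty ∧ f v ∈ openFace T := by
  obtain ⟨f, hf, hfi, hfb, hfs⟩ := exists_openFace_univ_charMap d
  set ι : Fin (d + 1) ↪ Fin k := (S.orderEmbOfFin hS).toEmbedding
  have hι : Finset.univ.map ι = S := by
    apply Finset.coe_injective
    rw [Finset.coe_map, Finset.coe_univ, image_univ]
    exact Finset.range_orderEmbOfFin S hS
  refine ⟨stdSimplex.map ι ∘ f, (stdSimplex.continuous_map ι).comp_continuousOn hf,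
    (stdSimplex_map_injective ι.injective).comp_injOn hfi, ?_, ?_⟩
  · rw [image_comp, hfb, image_map_openFace, hι]
  · intro v hv
    obtain ⟨T, hT, hvT⟩ := exists_mem_openFace (f v)
    refine ⟨T.map ι, ?_, hT.map, mem_openFace_map_iff.2 hvT⟩
    rw [← hι, Finset.map_ssubset_map]
    refine (Finset.subset_univ T).ssubset_of_ne ?_
    rintro rfl
    exact hfs v hv hvT

end Faces

/-! ### The product of a simplex and a CW complex -/

section Product

open Metric

variable {Y : Type u} [TopologicalSpace Y] [CWComplex (univ : Set Y)]

/-- The products of an open face of `Δ_{k-1}` and an open cell of `Y`, of total dimension `d`. -/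
def productCells (k : ℕ) (Y : Type u) [TopologicalSpace Y] [CWComplex (univ : Set Y)] (d : ℕ) :
    Set (Set (stdSimplex ℝ (Fin k) × Y)) :=
  {A | ∃ (S : Finset (Fin k)) (b : ℕ), ∃ E ∈ openCells Y b,
    S.Nonempty ∧ d + 1 = S.card + b ∧ A = openFace S ×ˢ E}

/-- A CW complex is a quotient of the disjoint union of its closed cells. -/
lemma isQuotientMap_closedCells [T2Space Y] :
    IsQuotientMap fun p : Σ i : (Σ n, RelCWComplex.cell (univ : Set Y) n),
      closedBall (0 : Fin i.1 → ℝ) 1 => RelCWComplex.map p.1.1 p.1.2 p.2.1 := by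
  have hcont (i : Σ n, RelCWComplex.cell (univ : Set Y) n) : Continuous
      fun v : closedBall (0 : Fin i.1 → ℝ) 1 => RelCWComplex.map i.1 i.2 v.1 :=
    continuousOn_iff_continuous_domRestrict.1 (RelCWComplex.continuousOn i.1 i.2)
  rw [isQuotientMap_iff_isClosed]
  refine ⟨fun y => ?_, fun A => ⟨fun hA => hA.preimage (continuous_sigma hcont), fun hA => ?_⟩⟩
  · have hy : y ∈ (univ : Set Y) := mem_univ y
    rw [← CWComplex.union (C := (univ : Set Y))] at hy
    simp only [mem_iUnion] at hy
    obtain ⟨n, j, v, hv, rfl⟩ := hy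
    exact ⟨⟨⟨n, j⟩, v, hv⟩, rfl⟩
  · rw [CWComplex.closed (univ : Set Y) A (subset_univ _)]
    intro n j
    have h := isClosed_sigma_iff.1 hA ⟨n, j⟩
    have : A ∩ RelCWComplex.closedCell n j =
        (fun v : closedBall (0 : Fin n → ℝ) 1 => RelCWComplex.map n j v.1) ''
          ((fun v : closedBall (0 : Fin n → ℝ) 1 => RelCWComplex.map n j v.1) ⁻¹' A) := by
      ext y
      constructor
      · rintro ⟨hy, v, hv, rfl⟩
        exact ⟨⟨v, hv⟩, hy, rfl⟩
      · rintro ⟨v, hv, rfl⟩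
        exact ⟨hv, v.1, v.2, rfl⟩
    rw [this]
    have : CompactSpace (closedBall (0 : Fin n → ℝ) 1) :=
      isCompact_iff_compactSpace.1 (isCompact_closedBall _ _)
    exact (IsCompact.image (IsClosed.isCompact h) (hcont ⟨n, j⟩)).isClosed

/-- The product of the quotient map of `isQuotientMap_closedCells` with the locally compact simplex
is again a quotient map, so the product topology is coherent with the products of closed cells. -/
lemma isClosed_of_inter_closure_productCells [T2Space Y] {k : ℕ}
    (A : Set (stdSimplex ℝ (Fin k) × Y))
    (hA : ∀ d, ∀ B ∈ productCells k Y d, IsClosed (A ∩ closure B)) : IsClosed A := by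
  have : CompactSpace (stdSimplex ℝ (Fin k)) :=
    isCompact_iff_compactSpace.1 (isCompact_stdSimplex ℝ (Fin k))
  have hcell (n : ℕ) (j : RelCWComplex.cell (univ : Set Y) n) :
      IsClosed (A ∩ univ ×ˢ RelCWComplex.closedCell n j) := by
    have : A ∩ univ ×ˢ RelCWComplex.closedCell n j = ⋃ S : {S : Finset (Fin k) // S.Nonempty},
        A ∩ closure (openFace S.1 ×ˢ RelCWComplex.openCell n j) := by
      simp only [closure_prod_eq, RelCWComplex.closure_openCell_eq_closedCell]
      ext p
      simp only [mem_inter_iff, mem_prod, mem_univ, true_and, mem_iUnion]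
      constructor
      · rintro ⟨hp, hpj⟩
        obtain ⟨S, hS, hpS⟩ := exists_mem_openFace p.1
        exact ⟨⟨S, hS⟩, hp, subset_closure hpS, hpj⟩
      · rintro ⟨_, hp, _, hpj⟩
        exact ⟨hp, hpj⟩
    rw [this]
    refine isClosed_iUnion_of_finite fun S => ?_
    refine hA (S.1.card + n - 1) _ ⟨S.1, n, _, ⟨j, rfl⟩, S.2, ?_, rfl⟩
    have := S.2.card_pos
    omega
  suffices h : Continuous fun p : Y × stdSimplex ℝ (Fin k) => (p.2, p.1) ∉ A by
    have h' : IsOpen {p : Y × stdSimplex ℝ (Fin k) | (p.2, p.1) ∉ A} := continuous_Prop.1 h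
    have : Aᶜ = Prod.swap ⁻¹' {p : Y × stdSimplex ℝ (Fin k) | (p.2, p.1) ∉ A} := rfl
    rw [← isOpen_compl_iff, this]
    exact h'.preimage continuous_swap
  refine isQuotientMap_closedCells.continuous_lift_prod_left ?_
  rw [continuous_Prop, ← Homeomorph.sigmaProdDistrib.symm.isOpen_preimage, isOpen_sigma_iff]
  rintro ⟨n, j⟩
  have hcont : Continuous fun p : closedBall (0 : Fin n → ℝ) 1 × stdSimplex ℝ (Fin k) =>
      (p.2, RelCWComplex.map n j p.1.1) :=
    continuous_snd.prodMk ((continuousOn_iff_continuous_domRestrict.1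
      (RelCWComplex.continuousOn (C := (univ : Set Y)) n j)).comp continuous_fst)
  have hcl := (hcell n j).preimage hcont
  rw [← isOpen_compl_iff] at hcl
  convert hcl using 1
  ext p
  have hp : RelCWComplex.map n j p.1.1 ∈ RelCWComplex.closedCell n j :=
    mem_image_of_mem _ p.1.2
  simp only [mem_compl_iff, mem_preimage, mem_inter_iff, mem_prod, mem_univ, hp, and_true]
  rfl

lemma isCellDecomposition_productCells [T2Space Y] (k : ℕ) :
    IsCellDecomposition (productCells k Y) where
  exists_charMap := by
    rintro d _ ⟨S, b, _, ⟨j, rfl⟩, hS, hd, rfl⟩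
    obtain ⟨s, hs⟩ : ∃ s, S.card = s + 1 := ⟨S.card - 1, by have := hS.card_pos; omega⟩
    obtain rfl : d = s + b := by omega
    obtain ⟨f, hf, hfi, hfb, hfs⟩ := exists_openFace_charMap S hs
    set g := RelCWComplex.map (C := (univ : Set Y)) b j
    have hg : ContinuousOn g (closedBall 0 1) := RelCWComplex.continuousOn b j
    have hgi : InjOn g (ball 0 1) := RelCWComplex.source_eq (C := (univ : Set Y)) b j ▸ g.injOn
    let l (v : Fin (s + b) → ℝ) : Fin s → ℝ := fun i => v (Fin.castAdd b i)
    let r (v : Fin (s + b) → ℝ) : Fin b → ℝ := fun i => v (Fin.natAdd s i)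
    have hl : Continuous l := by fun_prop
    have hr : Continuous r := by fun_prop
    have hball (v) : v ∈ ball (0 : Fin (s + b) → ℝ) 1 ↔ l v ∈ ball 0 1 ∧ r v ∈ ball 0 1 := by
      simp only [mem_ball_zero_iff, pi_norm_lt_iff one_pos, l, r]
      exact Fin.forall_fin_add (P := fun i => ‖v i‖ < 1)
    have hcball (v) : v ∈ closedBall (0 : Fin (s + b) → ℝ) 1 ↔
        l v ∈ closedBall 0 1 ∧ r v ∈ closedBall 0 1 := by
      simp only [mem_closedBall_zero_iff, pi_norm_le_iff_of_nonneg zero_le_one, l, r]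
      exact Fin.forall_fin_add (P := fun i => ‖v i‖ ≤ 1)
    have hinj {v w} (h₁ : l v = l w) (h₂ : r v = r w) : v = w := by
      funext i
      refine Fin.addCases (fun i => congrFun h₁ i) (fun i => congrFun h₂ i) i
    refine ⟨fun v => (f (l v), g (r v)), ?_, ?_, ?_, ?_⟩
    · exact (hf.comp hl.continuousOn fun v hv => ((hcball v).1 hv).1).prodMk
        (hg.comp hr.continuousOn fun v hv => ((hcball v).1 hv).2)
    · intro v hv w hw hvw
      obtain ⟨h₁, h₂⟩ := Prod.mk.inj hvw
      exact hinj (hfi ((hball v).1 hv).1 ((hball w).1 hw).1 h₁)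
        (hgi ((hball v).1 hv).2 ((hball w).1 hw).2 h₂)
    · rw [← hfb]
      apply subset_antisymm
      · rintro _ ⟨v, hv, rfl⟩
        exact ⟨mem_image_of_mem _ ((hball v).1 hv).1, mem_image_of_mem _ ((hball v).1 hv).2⟩
      · rintro ⟨_, _⟩ ⟨⟨v, hv, rfl⟩, w, hw, rfl⟩
        have hlv : l (Fin.append v w) = v := funext fun i => Fin.append_left v w i
        have hrw : r (Fin.append v w) = w := funext fun i => Fin.append_right v w i
        refine ⟨Fin.append v w, (hball _).2 ⟨hlv.symm ▸ hv, hrw.symm ▸ hw⟩, ?_⟩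
        exact Prod.ext (congrArg f hlv) (congrArg g hrw)
    · intro v hv
      obtain ⟨hv₁, hv₂⟩ := (hcball v).1 (sphere_subset_closedBall hv)
      have hv' : v ∉ ball (0 : Fin (s + b) → ℝ) 1 := by
        rw [mem_ball, mem_sphere.1 hv]
        exact lt_irrefl _
      -- On the boundary sphere, at least one of the two factors drops in dimension.
      suffices h : ∃ (T : Finset (Fin k)) (b' : ℕ), ∃ E ∈ openCells Y b', T.Nonempty ∧
          f (l v) ∈ openFace T ∧ g (r v) ∈ E ∧ T.card + b' < S.card + b by
        obtain ⟨T, b', E, hE, hT, hvT, hvE, hlt⟩ := h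
        have := hT.card_pos
        exact ⟨T.card + b' - 1, by omega, _, ⟨T, b', E, hE, hT, by omega, rfl⟩, hvT, hvE⟩
      by_cases hlv : l v ∈ ball 0 1
      · have hrv : r v ∈ sphere 0 1 :=
          ((mem_closedBall.1 hv₂).lt_or_eq).resolve_left fun h => hv' ((hball v).2 ⟨hlv, h⟩)
        obtain ⟨I, hI⟩ := CWComplex.cellFrontier_subset_finite_openCell b j
        have := hI (mem_image_of_mem g hrv)
        simp only [mem_iUnion] at this
        obtain ⟨m, hm, i, _, hvi⟩ := this
        exact ⟨S, m, _, ⟨i, rfl⟩, hS, hfb ▸ mem_image_of_mem f hlv, hvi, by omega⟩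
      · have hlv' : l v ∈ sphere 0 1 := ((mem_closedBall.1 hv₁).lt_or_eq).resolve_left hlv
        obtain ⟨T, hTS, hT, hvT⟩ := hfs _ hlv'
        obtain ⟨m, hm, E, hE, hvE⟩ := mem_skeleton_iff_openCells.1
          (RelCWComplex.closedCell_subset_skeleton b j (mem_image_of_mem g hv₂))
        have := Finset.card_lt_card hTS
        exact ⟨T, m, E, hE, hT, hvT, hvE, by omega⟩
  eq_of_mem := by
    rintro d d' _ _ ⟨t, y⟩ ⟨S, b, E, hE, hS, hd, rfl⟩ ⟨S', b', E', hE', hS', hd', rfl⟩ ⟨ht, hy⟩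
      ⟨ht', hy'⟩
    obtain rfl := eq_of_mem_openFace ht ht'
    obtain ⟨rfl, rfl⟩ := eq_of_mem_openCells hE hE' hy hy'
    exact ⟨by omega, rfl⟩
  closure_finite := by
    rintro d _ ⟨S, b, _, ⟨j, rfl⟩, hS, hd, rfl⟩
    obtain ⟨F, hF, hFc, hFj⟩ := closedCell_subset_finite b j
    refine ⟨image2 (fun (T : Finset (Fin k)) B => openFace T ×ˢ B) {T | T.Nonempty} F,
      (toFinite _).image2 _ hF, ?_, ?_⟩
    · rintro _ ⟨T, hT, B, hB, rfl⟩
      obtain ⟨m, hm⟩ := hFc B hB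
      have := Finset.Nonempty.card_pos hT
      exact ⟨T.card + m - 1, T, m, B, hm, hT, by omega, rfl⟩
    · rintro ⟨t, y⟩ h
      rw [closure_prod_eq, RelCWComplex.closure_openCell_eq_closedCell] at h
      obtain ⟨T, hT, htT⟩ := exists_mem_openFace t
      obtain ⟨B, hB, hyB⟩ := hFj h.2
      exact ⟨_, ⟨T, hT, B, hB, rfl⟩, htT, hyB⟩
  isClosed_of_inter := isClosed_of_inter_closure_productCells
  exists_mem := by
    rintro ⟨t, y⟩
    obtain ⟨T, hT, htT⟩ := exists_mem_openFace t
    obtain ⟨m, B, hB, hyB⟩ := exists_mem_openCells y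
    have := hT.card_pos
    exact ⟨T.card + m - 1, _, ⟨T, m, B, hB, hT, by omega, rfl⟩, htT, hyB⟩

end Product

/-! ### Points of the barycenter spaces as finitely supported measures -/

section Measures

variable {X : Type u}

lemma Power.ext_coord {k : ℕ} {x y : Power X k} (h : ∀ i, x.coord i = y.coord i) : x = y :=
  (CompactCoherentification.mk (Fin k → X)).symm.injective (funext h)

lemma Power.continuous_reindex [TopologicalSpace X] {k m : ℕ} (u : Fin m → Fin k) :
    Continuous (Power.reindex u : Power X k → Power X m) :=
  CompactCoherentification.continuous_map_of_continuous
    (continuous_pi fun i => continuous_apply (u i))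

lemma Power.continuous_coord [TopologicalSpace X] {k : ℕ} (i : Fin k) :
    Continuous fun x : Power X k => x.coord i :=
  (continuous_apply i).comp CompactCoherentification.continuous_mk_symm

/-- The integral `∑ t_i φ(x_i)` of a function against the measure `∑ t_i δ_{x_i}`. -/
def weightedSum (φ : X → ℝ) {k : ℕ} (p : SimplexPower X k) : ℝ :=
  ∑ i, p.1.1 i * φ (p.2.coord i)

lemma weightedSum_eq_of_step (φ : X → ℝ) {n : ℕ} {p q : PreBarycenter X n}
    (h : BarycenterStep X n p q) : weightedSum φ p.2 = weightedSum φ q.2 := by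
  rcases h with ⟨k, g, t, s, x, hs⟩ | ⟨k, hk, i, t, s, x, ht, hs⟩ |
      ⟨k, hk, i, j, hij, t, s, x, hx, hs⟩
  · change ∑ l, t.1 l * φ (x.coord l) = ∑ l, s.1 l * φ (x.coord (g l))
    simp only [hs]
    exact (Equiv.sum_comp g fun l => t.1 l * φ (x.coord l)).symm
  · change ∑ l, t.1 l * φ (x.coord l) = ∑ l, s.1 l * φ (x.coord (i.succAbove l))
    rw [Fin.sum_univ_succAbove _ i, ht]
    simp [hs]
  · change ∑ l, t.1 l * φ (x.coord l) = ∑ l, s.1 l * φ (x.coord (j.succAbove l))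
    rw [Fin.sum_univ_succAbove _ j]
    obtain ⟨i', rfl⟩ := Fin.exists_succAbove_eq hij
    simp only [hs, add_mul, Finset.sum_add_distrib, ite_mul, zero_mul]
    rw [add_comm, Finset.sum_eq_single (M := ℝ) (a := i')
      (f := fun l => if j.succAbove l = j.succAbove i' then t.1 j * φ (x.coord (j.succAbove l))
        else 0), if_pos rfl, ← hx]
    · intro l _ hl
      exact if_neg fun h => hl (Fin.succAbove_right_injective h)
    · simp

/-- The integral of a function against a point of the barycenter space. -/
def BarycenterSpace.integral (φ : X → ℝ) {n : ℕ} : BarycenterSpace X n → ℝ :=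
  Quot.lift (fun p => weightedSum φ p.2) fun _ _ h => weightedSum_eq_of_step φ h

lemma BarycenterSpace.continuous_integral [TopologicalSpace X] {φ : X → ℝ} (hφ : Continuous φ)
    (n : ℕ) : Continuous (BarycenterSpace.integral φ : BarycenterSpace X n → ℝ) := by
  refine isQuotientMap_quot_mk.continuous_iff.2 (continuous_sigma fun k => ?_)
  change Continuous fun p : SimplexPower X (k + 1) => ∑ i, p.1.1 i * φ (p.2.coord i)
  refine continuous_finsetSum _ fun i _ => Continuous.mul ?_ ?_
  · exact (continuous_apply i).comp (continuous_subtype_val.comp continuous_fst)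
  · exact hφ.comp ((Power.continuous_coord i).comp continuous_snd)

/-- The map from `Δ_k × X ^ (k + 1)` to the `n`-th barycenter space, for `k < n`. -/
def barycenterMk {n k : ℕ} (hk : k < n) (p : SimplexPower X (k + 1)) : BarycenterSpace X n :=
  Quot.mk _ ⟨⟨k, hk⟩, p⟩

lemma continuous_barycenterMk [TopologicalSpace X] {n k : ℕ} (hk : k < n) :
    Continuous (barycenterMk hk : SimplexPower X (k + 1) → BarycenterSpace X n) :=
  continuous_quot_mk.comp (continuous_sigmaMk (σ := fun k : Fin n => SimplexPower X (k + 1)))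

lemma exists_barycenterMk_eq {n : ℕ} (z : BarycenterSpace X n) :
    ∃ (k : ℕ) (hk : k < n) (p : SimplexPower X (k + 1)), barycenterMk hk p = z := by
  obtain ⟨⟨⟨k, hk⟩, p⟩, rfl⟩ := Quot.exists_rep z
  exact ⟨k, hk, p, rfl⟩

@[simp]
lemma integral_barycenterMk (φ : X → ℝ) {n k : ℕ} (hk : k < n) (p : SimplexPower X (k + 1)) :
    (barycenterMk hk p).integral φ = weightedSum φ p := rfl

/-- A pair `(t; x)` is reduced if all weights are positive and all points are distinct, so that no
weight can be suppressed and no two points can be merged. -/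
def IsReduced {k : ℕ} (p : SimplexPower X k) : Prop :=
  p.1 ∈ openFace Finset.univ ∧ Function.Injective p.2.coord

/-- Every point of a barycenter space has a reduced representative, obtained from a given one by
forgetting coordinates; its weights are at most as many as the positive weights given. -/
lemma exists_isReduced {n k : ℕ} (hk : k < n) (t : stdSimplex ℝ (Fin (k + 1)))
    (x : Power X (k + 1)) : ∃ (m : ℕ) (hm : m < n) (s : stdSimplex ℝ (Fin (m + 1)))
      (u : Fin (m + 1) → Fin (k + 1)), barycenterMk hm (s, x.reindex u) = barycenterMk hk (t, x) ∧
        IsReduced (s, x.reindex u) ∧ ∀ S, t ∈ openFace S → m + 1 ≤ S.card := by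
  induction k with
  | zero =>
    have : Subsingleton (Fin (0 + 1)) := inferInstanceAs (Subsingleton (Fin 1))
    have ht : t.1 0 = 1 := by simpa using t.2.2
    refine ⟨0, hk, t, id, rfl, ⟨fun i => ?_, Function.injective_of_subsingleton _⟩, ?_⟩
    · rw [Subsingleton.elim i 0]
      change 0 < t.1 0 ↔ _
      simp [ht]
    · intro S hS
      exact Finset.card_pos.2 ⟨0, (hS 0).1 (by rw [ht]; exact one_pos)⟩
  | succ k ih =>
    by_cases h0 : ∃ i, t.1 i = 0
    · obtain ⟨i, hi⟩ := h0
      let s : stdSimplex ℝ (Fin (k + 1)) := ⟨fun l => t.1 (i.succAbove l), fun l => t.2.1 _, by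
        have := t.2.2
        rwa [Fin.sum_univ_succAbove _ i, hi, zero_add] at this⟩
      obtain ⟨m, hm, s', u, h, hred, hcard⟩ := ih (by omega) s (x.reindex i.succAbove)
      refine ⟨m, hm, s', i.succAbove ∘ u, h.trans ?_, hred, fun S hS => ?_⟩
      · exact (Quot.sound (.drop k hk i t s x hi fun _ => rfl)).symm
      · obtain ⟨T, -, hT⟩ := exists_mem_openFace s
        refine (hcard T hT).trans ?_
        rw [← Finset.card_map i.succAboveEmb]
        refine Finset.card_le_card fun j hj => ?_
        obtain ⟨l, hl, rfl⟩ := Finset.mem_map.1 hj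
        exact (hS _).1 ((hT l).2 hl)
    · have hpos : ∀ i, 0 < t.1 i := fun i =>
        lt_of_le_of_ne (t.2.1 i) fun h => h0 ⟨i, h.symm⟩
      have htop : t ∈ openFace Finset.univ := fun i => iff_of_true (hpos i) (Finset.mem_univ i)
      by_cases hx : Function.Injective x.coord
      · refine ⟨k + 1, hk, t, id, rfl, ⟨htop, hx⟩, fun S hS => ?_⟩
        rw [eq_of_mem_openFace hS htop, Finset.card_univ, Fintype.card_fin]
      · obtain ⟨i, j, hxij, hij⟩ : ∃ i j, x.coord i = x.coord j ∧ i ≠ j := by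
          simpa [Function.Injective] using hx
        obtain ⟨i', rfl⟩ := Fin.exists_succAbove_eq hij
        -- Merging `x_j` into `x_i`: the new weights are all positive, one fewer than before.
        let s : stdSimplex ℝ (Fin (k + 1)) := ⟨fun l => t.1 (j.succAbove l) +
            if j.succAbove l = j.succAbove i' then t.1 j else 0, fun l => by
              have h₁ := (hpos (j.succAbove l)).le
              have h₂ := (hpos j).le
              dsimp only
              split_ifs <;> linarith, by
          have := t.2.2
          rw [Fin.sum_univ_succAbove _ j] at this
          rw [Finset.sum_add_distrib]
          simp only [Fin.succAbove_right_inj, Finset.sum_ite_eq', Finset.mem_univ, if_true]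
          linarith⟩
        obtain ⟨m, hm, s', u, h, hred, hcard⟩ := ih (by omega) s (x.reindex j.succAbove)
        refine ⟨m, hm, s', j.succAbove ∘ u, h.trans ?_, hred, fun S hS => ?_⟩
        · exact (Quot.sound (.merge k hk _ j hij t s x hxij fun _ => rfl)).symm
        · obtain ⟨T, -, hT⟩ := exists_mem_openFace s
          have := hcard T hT
          have hT' := T.card_le_univ
          rw [eq_of_mem_openFace hS htop, Finset.card_univ]
          simp only [Fintype.card_fin] at hT' ⊢
          omega

lemma weightedSum_single_coord [DecidableEq X] {k : ℕ} {p : SimplexPower X k}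
    (hp : IsReduced p) (i : Fin k) : weightedSum (Pi.single (p.2.coord i) 1) p = p.1.1 i := by
  rw [weightedSum, Finset.sum_eq_single i]
  · simp
  · intro j _ hj
    rw [Pi.single_eq_of_ne (hp.2.ne hj), mul_zero]
  · simp

lemma exists_coord_eq_of_weightedSum_eq {k k' : ℕ} {p : SimplexPower X k} {q : SimplexPower X k'}
    (hq : IsReduced q) (h : ∀ φ : X → ℝ, weightedSum φ p = weightedSum φ q) (l : Fin k') :
    ∃ i, p.2.coord i = q.2.coord l := by
  classical
  by_contra! hne
  have h₁ := h (Pi.single (q.2.coord l) 1)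
  rw [weightedSum_single_coord hq, weightedSum, Finset.sum_eq_zero] at h₁
  · exact ((hq.1 l).2 (Finset.mem_univ l)).ne h₁
  · intro i _
    rw [Pi.single_eq_of_ne (hne i), mul_zero]

/-- Reduced representatives of the same measure differ by a permutation. -/
lemma exists_equiv_of_weightedSum_eq {k k' : ℕ} {p : SimplexPower X k} {q : SimplexPower X k'}
    (hp : IsReduced p) (hq : IsReduced q) (h : ∀ φ : X → ℝ, weightedSum φ p = weightedSum φ q) :
    ∃ g : Fin k' ≃ Fin k, (∀ l, q.1.1 l = p.1.1 (g l)) ∧ ∀ l, q.2.coord l = p.2.coord (g l) := by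
  classical
  choose g hg using exists_coord_eq_of_weightedSum_eq hq h
  have hbij : Function.Bijective g := by
    constructor
    · intro l l' hl
      exact hq.2 ((hg l).symm.trans ((congrArg _ hl).trans (hg l')))
    · intro i
      obtain ⟨l, hl⟩ := exists_coord_eq_of_weightedSum_eq hp (fun φ => (h φ).symm) i
      exact ⟨l, hp.2 ((hg l).trans hl)⟩
  refine ⟨Equiv.ofBijective g hbij, fun l => ?_, fun l => (hg l).symm⟩
  rw [← weightedSum_single_coord hq l, ← h, ← hg l, weightedSum_single_coord hp]
  rfl

lemma barycenterMk_eq_of_perm {n k : ℕ} (hk : k < n) (g : Equiv.Perm (Fin (k + 1)))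
    {t s : stdSimplex ℝ (Fin (k + 1))} {x y : Power X (k + 1)} (hs : ∀ l, s.1 l = t.1 (g l))
    (hy : ∀ l, y.coord l = x.coord (g l)) : barycenterMk hk (t, x) = barycenterMk hk (s, y) := by
  obtain rfl : y = x.reindex g := Power.ext_coord hy
  exact Quot.sound (.perm ⟨k, hk⟩ g t s x hs)

/-- Points of the barycenter space are determined by their measures. -/
lemma BarycenterSpace.ext_integral {n : ℕ} {z w : BarycenterSpace X n}
    (h : ∀ φ : X → ℝ, z.integral φ = w.integral φ) : z = w := by
  obtain ⟨k, hk, ⟨t, x⟩, rfl⟩ := exists_barycenterMk_eq z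
  obtain ⟨k', hk', ⟨t', x'⟩, rfl⟩ := exists_barycenterMk_eq w
  obtain ⟨m, hm, s, u, hsu, hred, -⟩ := exists_isReduced hk t x
  obtain ⟨m', hm', s', u', hsu', hred', -⟩ := exists_isReduced hk' t' x'
  rw [← hsu, ← hsu'] at h ⊢
  obtain ⟨g, hg₁, hg₂⟩ := exists_equiv_of_weightedSum_eq hred hred' h
  obtain rfl : m = m' := by simpa using (Fin.equiv_iff_eq.1 ⟨g⟩).symm
  exact barycenterMk_eq_of_perm hm g hg₁ hg₂

/-- Barycenter spaces of CW complexes are Hausdorff: distinct measures are separated by the integral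
of some function, which may be taken continuous as only its values on the supports matter. -/
theorem t2Space_barycenterSpace [TopologicalSpace X] [T2Space X] [CWComplex (univ : Set X)]
    (n : ℕ) : T2Space (BarycenterSpace X n) := by
  refine ⟨fun z w hzw => ?_⟩
  obtain ⟨φ, hφ⟩ : ∃ φ : X → ℝ, z.integral φ ≠ w.integral φ := by
    by_contra! h
    exact hzw (BarycenterSpace.ext_integral h)
  obtain ⟨k, hk, p, rfl⟩ := exists_barycenterMk_eq z
  obtain ⟨k', hk', q, rfl⟩ := exists_barycenterMk_eq w
  obtain ⟨ψ, hψ, hψφ⟩ := exists_continuous_eqOn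
    ((finite_range p.2.coord).union (finite_range q.2.coord)) φ
  have hp : weightedSum ψ p = weightedSum φ p :=
    Finset.sum_congr rfl fun i _ => by rw [hψφ (.inl ⟨i, rfl⟩)]
  have hq : weightedSum ψ q = weightedSum φ q :=
    Finset.sum_congr rfl fun i _ => by rw [hψφ (.inr ⟨i, rfl⟩)]
  refine separated_by_continuous (BarycenterSpace.continuous_integral hψ n) ?_
  simpa only [integral_barycenterMk, hp, hq] using hφ

end Measures

/-! ### The cells of the barycenter spaces -/

section Cells

variable {X : Type u} [TopologicalSpace X] [∀ k, CWComplex (univ : Set (Power X k))]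

/-- The open cells of the `n`-th barycenter space: the images of the products of the open top face
of `Δ_k` with an open cell of `X ^ (k + 1)` that avoids the fat diagonal. Permuting the coordinates
gives the same image, so there is one cell for each orbit. -/
def barycenterCells (X : Type u) [TopologicalSpace X] [∀ k, CWComplex (univ : Set (Power X k))]
    (n d : ℕ) : Set (Set (BarycenterSpace X n)) :=
  {A | ∃ (k : ℕ) (hk : k < n) (b : ℕ), ∃ E ∈ openCells (Power X (k + 1)) b,
    (∀ x ∈ E, Function.Injective x.coord) ∧ d = k + b ∧
      A = barycenterMk hk '' (openFace Finset.univ ×ˢ E)}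

variable [T2Space X] [CWComplex (univ : Set X)] {x₀ : X} (hX : IsEquivariantCWPowers X x₀)

include hX

lemma image_reindex_mem_openCells {k b : ℕ} (g : Equiv.Perm (Fin k)) {E : Set (Power X k)}
    (hE : E ∈ openCells (Power X k) b) : Power.reindex g '' E ∈ openCells (Power X k) b := by
  obtain ⟨e, rfl⟩ := hE
  obtain ⟨e', he'⟩ := hX.perm_cell k g b e
  exact ⟨e', he'.symm⟩

/-- A permutation taking one point of an open cell into that cell fixes the cell pointwise. -/
lemma reindex_eq_of_mem {k b : ℕ} (g : Equiv.Perm (Fin k)) {E : Set (Power X k)}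
    (hE : E ∈ openCells (Power X k) b) {x y : Power X k} (hx : x ∈ E) (hgx : x.reindex g ∈ E)
    (hy : y ∈ E) : y.reindex g = y := by
  have h := (eq_of_mem_openCells (image_reindex_mem_openCells hX g hE) hE
    (mem_image_of_mem _ hx) hgx).2
  obtain ⟨e, rfl⟩ := hE
  exact hX.perm_fix k g b e h y hy

/-- An open cell of `X ^ k` either lies in the fat diagonal or avoids it. -/
lemma injective_coord_of_mem {k b : ℕ} {E : Set (Power X k)} (hE : E ∈ openCells (Power X k) b)
    {x y : Power X k} (hx : x ∈ E) (hy : y ∈ E) (hxi : Function.Injective x.coord) :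
    Function.Injective y.coord := by
  intro i j hij
  have hswap : y.reindex (Equiv.swap i j) = y := by
    refine Power.ext_coord fun l => ?_
    change y.coord (Equiv.swap i j l) = y.coord l
    rcases eq_or_ne l i with rfl | hi
    · rw [Equiv.swap_apply_left, hij]
    rcases eq_or_ne l j with rfl | hj
    · rw [Equiv.swap_apply_right, hij]
    · rw [Equiv.swap_apply_of_ne_of_ne hi hj]
  have h := reindex_eq_of_mem hX (Equiv.swap i j) hE hy (hswap.symm ▸ hy) hx
  have h' : x.coord (Equiv.swap i j i) = x.coord i := congrArg (fun z : Power X k => z.coord i) h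
  rw [Equiv.swap_apply_left] at h'
  exact (hxi h').symm

/-- Forgetting and permuting coordinates does not raise the dimension. -/
lemma exists_reindex_mem_openCells {k m : ℕ} {u : Fin m → Fin k} (hu : Function.Injective u)
    {b : ℕ} {E : Set (Power X k)} (hE : E ∈ openCells (Power X k) b) {x : Power X k} (hx : x ∈ E) :
    ∃ b' ≤ b, ∃ E' ∈ openCells (Power X m) b', x.reindex u ∈ E' := by
  induction k generalizing b m with
  | zero =>
    obtain rfl : m = 0 := by simpa using Fintype.card_le_of_injective u hu
    exact ⟨b, le_rfl, E, hE, by convert hx; exact Power.ext_coord fun i => i.elim0⟩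
  | succ k ih =>
    by_cases hs : Function.Surjective u
    · have hbij : Function.Bijective u := ⟨hu, hs⟩
      obtain rfl : m = k + 1 := by simpa using Fintype.card_of_bijective hbij
      exact ⟨b, le_rfl, _, image_reindex_mem_openCells hX (Equiv.ofBijective u hbij) hE,
        x, hx, rfl⟩
    · obtain ⟨i, hi⟩ : ∃ i, ∀ l, u l ≠ i := by simpa [Function.Surjective] using hs
      choose u' hu' using fun l => Fin.exists_succAbove_eq (hi l)
      obtain rfl : u = i.succAbove ∘ u' := funext fun l => (hu' l).symm
      have hmem : x.reindex i.succAbove ∈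
          (RelCWComplex.skeleton (univ : Set (Power X k)) b : Set (Power X k)) :=
        (hX.forget_cellular k i).2 b (mem_skeleton_iff_openCells.2 ⟨b, le_rfl, E, hE, hx⟩)
      obtain ⟨b₁, hb₁, E₁, hE₁, hx₁⟩ := mem_skeleton_iff_openCells.1 hmem
      obtain ⟨b', hb', E', hE', hx'⟩ := ih (Function.Injective.of_comp hu) hE₁ hx₁
      exact ⟨b', hb'.trans hb₁, E', hE', hx'⟩

/-- Two cells with a common point are equal: reduced representatives of that point differ by a
permutation, which carries one cell of the power of `X` to the other. -/
lemma eq_of_mem_barycenterCells {n d d' : ℕ} {A B : Set (BarycenterSpace X n)}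
    {z : BarycenterSpace X n} (hA : A ∈ barycenterCells X n d) (hB : B ∈ barycenterCells X n d')
    (hzA : z ∈ A) (hzB : z ∈ B) : d = d' ∧ A = B := by
  obtain ⟨k, hk, b, E, hE, hEi, rfl, rfl⟩ := hA
  obtain ⟨k', hk', b', E', hE', hEi', rfl, rfl⟩ := hB
  obtain ⟨⟨t, x⟩, ⟨ht, hx⟩, rfl⟩ := hzA
  obtain ⟨⟨s, y⟩, ⟨hs, hy⟩, hsy⟩ := hzB
  obtain ⟨g, hgt, hgx⟩ := exists_equiv_of_weightedSum_eq (p := (t, x)) (q := (s, y))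
    ⟨ht, hEi x hx⟩ ⟨hs, hEi' y hy⟩ fun φ => (congrArg (BarycenterSpace.integral φ) hsy).symm
  obtain rfl : k = k' := by simpa using (Fin.equiv_iff_eq.1 ⟨g⟩).symm
  have hxy : x.reindex g ∈ E' := by
    convert hy
    exact Power.ext_coord fun l => (hgx l).symm
  obtain ⟨rfl, rfl⟩ := eq_of_mem_openCells (image_reindex_mem_openCells hX g hE) hE'
    (mem_image_of_mem _ hx) hxy
  refine ⟨rfl, ?_⟩
  apply subset_antisymm
  · rintro _ ⟨⟨t, x⟩, ⟨ht, hx⟩, rfl⟩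
    refine ⟨(⟨fun l => t.1 (g l), fun l => t.2.1 _, (Equiv.sum_comp g _).trans t.2.2⟩, x.reindex g),
      ⟨fun l => ?_, mem_image_of_mem _ hx⟩, ?_⟩
    · simpa using ht (g l)
    · exact (barycenterMk_eq_of_perm hk g (fun _ => rfl) fun _ => rfl).symm
  · rintro _ ⟨⟨s, _⟩, ⟨hs, x, hx, rfl⟩, rfl⟩
    refine ⟨(⟨fun l => s.1 (g.symm l), fun l => s.2.1 _, (Equiv.sum_comp g.symm _).trans s.2.2⟩, x),
      ⟨fun l => ?_, hx⟩, ?_⟩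
    · simpa using hs (g.symm l)
    · exact barycenterMk_eq_of_perm hk g (fun l => by simp) fun _ => rfl

/-- Two reduced pairs in the product with the same image differ by a permutation, which preserves the
cell `E`, hence fixes it pointwise. -/
lemma injOn_barycenterMk {n k b : ℕ} (hk : k < n) {E : Set (Power X (k + 1))}
    (hE : E ∈ openCells (Power X (k + 1)) b) (hEi : ∀ x ∈ E, Function.Injective x.coord) :
    InjOn (barycenterMk hk) (openFace Finset.univ ×ˢ E) := by
  rintro ⟨t, x⟩ ⟨ht, hx⟩ ⟨s, y⟩ ⟨hs, hy⟩ h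
  obtain ⟨g, hgt, hgx⟩ := exists_equiv_of_weightedSum_eq (p := (t, x)) (q := (s, y))
    ⟨ht, hEi x hx⟩ ⟨hs, hEi y hy⟩ fun φ => congrArg (BarycenterSpace.integral φ) h
  have hxy : x.reindex g = y := Power.ext_coord fun l => (hgx l).symm
  have hxx : x.reindex g = x := reindex_eq_of_mem hX g hE hx (hxy ▸ hy) hx
  -- The coordinates of `x` are distinct, so a permutation fixing `x` is trivial.
  have hg : ∀ l, g l = l := fun l =>
    hEi x hx (congrArg (fun z : Power X (k + 1) => z.coord l) hxx)
  refine Prod.ext (Subtype.ext (funext fun l => ?_)) (hxx.symm.trans hxy)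
  exact ((hgt l).trans (by rw [hg l])).symm

/-- The projection to the barycenter space does not raise the dimension of a product cell. -/
lemma exists_barycenterMk_mem_barycenterCells {n k d : ℕ} (hk : k < n)
    {A : Set (SimplexPower X (k + 1))} (hA : A ∈ productCells (k + 1) (Power X (k + 1)) d)
    {p : SimplexPower X (k + 1)} (hp : p ∈ A) :
    ∃ m ≤ d, ∃ B ∈ barycenterCells X n m, barycenterMk hk p ∈ B := by
  obtain ⟨S, b, E, hE, hS, hd, rfl⟩ := hA
  obtain ⟨t, x⟩ := p
  obtain ⟨m, hm, s, u, h, hred, hcard⟩ := exists_isReduced hk t x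
  have hu : Function.Injective u := Function.Injective.of_comp (f := x.coord) hred.2
  obtain ⟨b', hb', E', hE', hx'⟩ := exists_reindex_mem_openCells hX hu hE hp.2
  have := hcard S hp.1
  refine ⟨m + b', by omega, _, ⟨m, hm, b', E', hE', ?_, rfl, rfl⟩, ?_⟩
  · exact fun y hy => injective_coord_of_mem hX hE' hx' hy hred.2
  · rw [← h]
    exact ⟨_, ⟨hred.1, hx'⟩, rfl⟩

lemma exists_mem_barycenterCells {n : ℕ} (z : BarycenterSpace X n) :
    ∃ d, ∃ A ∈ barycenterCells X n d, z ∈ A := by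
  obtain ⟨k, hk, p, rfl⟩ := exists_barycenterMk_eq z
  obtain ⟨d, A, hA, hp⟩ := (isCellDecomposition_productCells (k + 1)).exists_mem p
  obtain ⟨m, -, B, hB, hpB⟩ := exists_barycenterMk_mem_barycenterCells hX hk hA hp
  exact ⟨m, B, hB, hpB⟩

/-- The image of a compact set meets only finitely many cells: reduced representatives arise from
finitely many ways of forgetting coordinates, each of which preserves compactness. -/
lemma exists_finite_barycenterCells {n k : ℕ} (hk : k < n) {K : Set (SimplexPower X (k + 1))}
    (hK : IsCompact K) : ∃ F : Set (Set (BarycenterSpace X n)), F.Finite ∧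
      (∀ B ∈ F, ∃ m, B ∈ barycenterCells X n m) ∧ barycenterMk hk '' K ⊆ ⋃₀ F := by
  let G (m : Fin n) (u : Fin (m + 1) → Fin (k + 1)) : Set (Set (Power X (m + 1))) :=
    {E | (∃ b, E ∈ openCells (Power X (m + 1)) b) ∧
      (E ∩ Power.reindex u '' (Prod.snd '' K)).Nonempty}
  have hG (m u) : (G m u).Finite := finite_openCells_inter_compact
    ((hK.image continuous_snd).image (Power.continuous_reindex u))
  refine ⟨{B | (∃ d, B ∈ barycenterCells X n d) ∧ ∃ (m : Fin n) (u : Fin (m + 1) → Fin (k + 1)),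
    ∃ E ∈ G m u, B = barycenterMk m.2 '' (openFace Finset.univ ×ˢ E)}, ?_, fun B hB => hB.1, ?_⟩
  · refine Set.Finite.subset (s := ⋃ (m : Fin n) (u : Fin (m + 1) → Fin (k + 1)),
      (fun E => barycenterMk m.2 '' (openFace Finset.univ ×ˢ E)) '' G m u) ?_ ?_
    · exact finite_iUnion fun m => finite_iUnion fun u => (hG m u).image _
    · rintro B ⟨-, m, u, E, hE, rfl⟩
      simp only [mem_iUnion]
      exact ⟨m, u, E, hE, rfl⟩
  · rintro _ ⟨⟨t, x⟩, hp, rfl⟩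
    obtain ⟨m, hm, s, u, h, hred, -⟩ := exists_isReduced hk t x
    obtain ⟨b, E, hE, hx⟩ := exists_mem_openCells (x.reindex u)
    refine ⟨barycenterMk hm '' (openFace Finset.univ ×ˢ E), ⟨⟨m + b, m, hm, b, E, hE, ?_, rfl, rfl⟩,
      ⟨m, hm⟩, u, E, ⟨⟨b, hE⟩, x.reindex u, hx, x, ⟨_, hp, rfl⟩, rfl⟩, rfl⟩, ?_⟩
    · exact fun y hy => injective_coord_of_mem hX hE hx hy hred.2
    · rw [← h]
      exact ⟨_, ⟨hred.1, hx⟩, rfl⟩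

/-- The cells of the barycenter spaces form a CW structure, with characteristic maps the composites
of those of the products with the projection. -/
theorem isCellDecomposition_barycenterCells (n : ℕ) :
    IsCellDecomposition (barycenterCells X n) where
  exists_charMap := by
    rintro d _ ⟨k, hk, b, E, hE, hEi, rfl, rfl⟩
    obtain ⟨f, hf, hfi, hfE, hfs⟩ := (isCellDecomposition_productCells (k + 1)).exists_charMap
      (k + b) _ ⟨Finset.univ, b, E, hE, Finset.univ_nonempty, by simp; omega, rfl⟩
    refine ⟨barycenterMk hk ∘ f, (continuous_barycenterMk hk).comp_continuousOn hf, ?_, ?_, ?_⟩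
    · exact (injOn_barycenterMk hX hk hE hEi).comp hfi (mapsTo_iff_image_subset.2 hfE.subset)
    · rw [image_comp, hfE]
    · intro v hv
      obtain ⟨m, hm, A, hA, hvA⟩ := hfs v hv
      obtain ⟨m', hm', B, hB, hvB⟩ := exists_barycenterMk_mem_barycenterCells hX hk hA hvA
      exact ⟨m', hm'.trans_lt hm, B, hB, hvB⟩
  eq_of_mem := eq_of_mem_barycenterCells hX
  closure_finite := by
    have := t2Space_barycenterSpace (X := X) n
    rintro d _ ⟨k, hk, b, E, hE, hEi, rfl, rfl⟩
    have hK := (isCellDecomposition_productCells (k + 1)).isCompact_closure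
      (A := openFace Finset.univ ×ˢ E) (d := k + b)
      ⟨Finset.univ, b, E, hE, Finset.univ_nonempty, by simp; omega, rfl⟩
    obtain ⟨F, hF, hFc, hFK⟩ := exists_finite_barycenterCells hX hk hK
    exact ⟨F, hF, hFc, (closure_minimal (image_mono subset_closure)
      (hK.image (continuous_barycenterMk hk)).isClosed).trans hFK⟩
  isClosed_of_inter := by
    intro A hA
    refine isQuotientMap_quot_mk.isClosed_preimage.1 (isClosed_sigma_iff.2 ?_)
    rintro ⟨k, hk⟩
    refine (isCellDecomposition_productCells (k + 1)).isClosed_of_inter _ fun d B hB => ?_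
    have hK := (isCellDecomposition_productCells (k + 1)).isCompact_closure hB
    obtain ⟨F, hF, hFc, hFK⟩ := exists_finite_barycenterCells hX hk hK
    have : barycenterMk hk ⁻¹' A ∩ closure B =
        barycenterMk hk ⁻¹' (⋃ C ∈ F, A ∩ closure C) ∩ closure B := by
      ext p
      simp only [mem_inter_iff, mem_preimage, mem_iUnion]
      constructor
      · rintro ⟨hp, hpB⟩
        obtain ⟨C, hC, hpC⟩ := hFK (mem_image_of_mem _ hpB)
        exact ⟨⟨C, hC, hp, subset_closure hpC⟩, hpB⟩
      · rintro ⟨⟨C, -, hp, -⟩, hpB⟩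
        exact ⟨hp, hpB⟩
    change IsClosed (barycenterMk hk ⁻¹' A ∩ closure B)
    rw [this]
    refine IsClosed.inter (IsClosed.preimage (continuous_barycenterMk hk) ?_) isClosed_closure
    refine hF.isClosed_biUnion fun C hC => ?_
    obtain ⟨m, hm⟩ := hFc C hC
    exact hA m C hm
  exists_mem := exists_mem_barycenterCells hX

end Cells

/-! ### Inclusions -/

section Inclusions

variable {X : Type u}

lemma weightedSum_simplexPowerIncl (φ : X → ℝ) (x₀ : X) {k n : ℕ} (h : k ≤ n)
    (p : SimplexPower X k) : weightedSum φ (simplexPowerIncl x₀ h p) = weightedSum φ p := by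
  symm
  refine Fintype.sum_of_injective (Fin.castLE h) (Fin.castLE_injective h) _ _ ?_ fun i => ?_
  · intro j hj
    change (stdSimplex.map (Fin.castLE h) p.1).1 j * _ = 0
    rw [stdSimplex_map_apply_of_notMem _ hj, zero_mul]
  · have hcoord : (p.2.adjoin x₀ k n).coord (Fin.castLE h i) = p.2.coord i := dif_pos i.2
    change _ = (stdSimplex.map (Fin.castLE h) p.1).1 _ * φ ((p.2.adjoin x₀ k n).coord _)
    rw [stdSimplex_map_apply (Fin.castLE_injective h), hcoord]

@[simp]
lemma integral_barycenterIncl (φ : X → ℝ) {k n : ℕ} (h : k ≤ n) (z : BarycenterSpace X k) :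
    (barycenterIncl h z).integral φ = z.integral φ := by
  obtain ⟨p, rfl⟩ := Quot.exists_rep z
  rfl

lemma barycenterIncl_injective {k n : ℕ} (h : k ≤ n) :
    Function.Injective (barycenterIncl (X := X) h) := fun z w hzw =>
  BarycenterSpace.ext_integral fun φ => by
    rw [← integral_barycenterIncl φ h, hzw, integral_barycenterIncl]

lemma continuous_barycenterIncl [TopologicalSpace X] {k n : ℕ} (h : k ≤ n) :
    Continuous (barycenterIncl (X := X) h) :=
  isQuotientMap_quot_mk.continuous_iff.2
    (continuous_sigma fun i => continuous_barycenterMk (i.2.trans_le h))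

lemma image_barycenterIncl_mem_barycenterCells [TopologicalSpace X]
    [∀ k, CWComplex (univ : Set (Power X k))] {k n d : ℕ} (h : k ≤ n)
    {A : Set (BarycenterSpace X k)} (hA : A ∈ barycenterCells X k d) :
    barycenterIncl h '' A ∈ barycenterCells X n d := by
  obtain ⟨i, hi, b, E, hE, hEi, hd, rfl⟩ := hA
  exact ⟨i, hi.trans_le h, b, E, hE, hEi, hd, by rw [← image_comp]; rfl⟩

lemma image_simplexPowerIncl_mem_productCells [TopologicalSpace X]
    [∀ k, CWComplex (univ : Set (Power X k))] [T2Space X] [CWComplex (univ : Set X)] {x₀ : X}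
    (hX : IsEquivariantCWPowers X x₀) {k n d : ℕ} (h : k ≤ n) {A : Set (SimplexPower X k)}
    (hA : A ∈ productCells k (Power X k) d) :
    simplexPowerIncl x₀ h '' A ∈ productCells n (Power X n) d := by
  obtain ⟨S, b, _, ⟨e, rfl⟩, hS, hd, rfl⟩ := hA
  obtain ⟨e', he'⟩ := (hX.adjoin_subcomplex k n h).2.2 b e
  refine ⟨S.map (Fin.castLEEmb h), b, _, ⟨e', rfl⟩, hS.map, by rwa [Finset.card_map], ?_⟩
  rw [← image_map_openFace, ← he']
  exact (prod_image_image_eq (m₁ := stdSimplex.map (Fin.castLE h))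
    (m₂ := Power.adjoin x₀ k n)).symm

end Inclusions

end BarycenterCW

end
open BarycenterCW in
theorem proposition7p1 {X : Type u} [TopologicalSpace X] [T2Space X] [ConnectedSpace X]
    [CWComplex (univ : Set X)] (x₀ : X) [∀ k, CWComplex (univ : Set (Power X k))]
    (hX : IsEquivariantCWPowers X x₀) :
    ∃ (_ : ∀ n, T2Space (BarycenterSpace X n))
      (_ : ∀ n, CWComplex (univ : Set (BarycenterSpace X n)))
      (_ : ∀ k, CWComplex (univ : Set (SimplexPower X k))),
      (∀ k, IsProductCW (X := X) k) ∧
      (∀ k, IsCellular (barycenterProj (X := X) k)) ∧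
      (∀ (k n : ℕ) (h : k ≤ n),
        IsSubcomplexInclusion (simplexPowerIncl x₀ h) ∧
        IsSubcomplexInclusion (barycenterIncl (X := X) h)) ∧
      ∀ (k n : ℕ) (h : k + 1 ≤ n + 1) (p : SimplexPower X (k + 1)),
        barycenterProj n (simplexPowerIncl x₀ h p) = barycenterIncl h (barycenterProj k p) := by
  have hT2 (n : ℕ) : T2Space (BarycenterSpace X n) := t2Space_barycenterSpace n
  choose cwB hB using fun n => (isCellDecomposition_barycenterCells hX n).exists_cwComplex
  choose cwP hP using fun k =>
    (isCellDecomposition_productCells (Y := Power X k) k).exists_cwComplex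
  refine ⟨hT2, cwB, cwP, fun k d A => ?_, fun k => ⟨continuous_barycenterMk _, fun d p hp => ?_⟩,
    fun k n h => ⟨?_, ?_⟩, fun k n h p => ?_⟩
  · refine (Set.ext_iff.1 (hP k d) A).trans ?_
    constructor
    · rintro ⟨S, b, _, ⟨e, rfl⟩, hA⟩
      exact ⟨S, b, e, hA⟩
    · rintro ⟨S, b, e, hA⟩
      exact ⟨S, b, _, ⟨e, rfl⟩, hA⟩
  · obtain ⟨m, hm, A, hA, hpA⟩ := mem_skeleton_iff_openCells.1 hp
    rw [hP] at hA
    obtain ⟨m', hm', B, hmB, hpB⟩ :=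
      exists_barycenterMk_mem_barycenterCells hX k.lt_succ_self hA hpA
    exact mem_skeleton_iff_openCells.2 ⟨m', hm'.trans hm, B, by rwa [hB], hpB⟩
  · have hadj := (hX.adjoin_subcomplex k n h).1
    refine isSubcomplexInclusion_of_openCells
      ((stdSimplex.continuous_map _).prodMap hadj.continuous)
      ((stdSimplex_map_injective (Fin.castLE_injective h)).prodMap hadj.injective) fun d A hA => ?_
    rw [hP] at hA ⊢
    exact image_simplexPowerIncl_mem_productCells hX h hA
  · refine isSubcomplexInclusion_of_openCells (continuous_barycenterIncl h)
      (barycenterIncl_injective h) fun d A hA => ?_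
    rw [hB] at hA ⊢
    exact image_barycenterIncl_mem_barycenterCells h hA
  · refine BarycenterSpace.ext_integral fun φ => ?_
    rw [integral_barycenterIncl]
    exact weightedSum_simplexPowerIncl φ x₀ h p
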